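/- Let $\rho\in(-1,1)$, $\bar\rho=\sqrt{1-\rho^2}$, $\beta\in[0,1]$, $S=\mathbb R\times(0,\infty)$ and $\mathcal S=(0,\infty)^2$; for $x<0$ read $x^{\gamma}$ as $|x|^{\gamma}$. For $j\in\{0,1\}$ let $m_j(x,y)=\frac{1}{\bar\rho\,|x|^{\beta(1+j)}y^2}$, $\mathcal H_j=L^2(S,m_j\,dx\,dy)$ and $$\mathcal E_{m_j}(f_1,f_2)=\frac12\int_S\Gamma(f_1,f_2)\,m_j\,dx\,dy,\qquad \Gamma(f_1,f_2)=y^2\bigl(|x|^{2\beta}\partial_xf_1\partial_xf_2+\rho|x|^{\beta}(\partial_xf_1\partial_yf_2+\partial_yf_1\partial_xf_2)+\partial_yf_1\partial_yf_2\bigr).$$ Let $D(\mathcal E_{m_j})$ be the set of all $u\in\mathcal H_j$ such that for almost every $\bar y>0$ the function $x\mapsto u(x,\bar y)$ has a version that is absolutely continuous on the compact intervals of $\mathbb R$, for almost every $\bar x\in\mathbb R$ the function $y\mapsto u(\bar x,y)$ has a version that is absolutely continuous on the compact intervals of $(0,\infty)$, and $\Gamma(u,u)\in L^1(S,m_j\,dx\,dy)$,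 the partial derivatives being those of these versions. A symmetric form on a real Hilbert space $\mathcal H$ is a nonnegative symmetric bilinear form $\mathcal E$ on a dense subspace $D$; it is closed if $D$ is complete for the norm $(\mathcal E(u,u)+\|u\|^2)^{1/2}$, and closable if it has a closed extension. A Dirichlet form on an $L^2$ space is a closed form such that $u\in D$ implies $u^+\wedge1\in D$ and $\mathcal E(u^+\wedge1,u^+\wedge1)\le\mathcal E(u,u)$. The generator $\Phi(\mathcal E)$ of a form is given by: $u\in D(\Phi(\mathcal E))$ and $\Phi(\mathcal E)u=w$ if and only if $u\in D$, $w\in\mathcal H$ and $\mathcal E(u,v)=-(w,v)_{\mathcal H}$ for all $v\in D$. Put $$Af=\tfrac12y^2\bigl(x^{2\beta}\partial_{xx}f+2\rho x^{\beta}\partial_{xy}f+\partial_{yy}f\bigr),\qquad \Delta_gf=\tfrac{\beta}{2}y^2x^{2\beta-1}\partial_xf+Af .$$ **Theorem.** The spaces $\mathcal H_0,\mathcal H_1$ are Hilbert spaces, and the following holds. (i) If $j=0$ and $\beta\in[0,1)$, or $j=1$ and $\beta\in[0,1/2)$, then $C_0^\infty(S)\subset\mathcal H_j$, and $(\mathcal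 E_{m_j},C_0^\infty(S))$ is a symmetric form on $\mathcal H_j$ and is closable. (ii) In the same cases $(\mathcal E_{m_j},D(\mathcal E_{m_j}))$ is a Dirichlet form on $\mathcal H_j$, and it extends $(\mathcal E_{m_j},C_0^\infty(S))$. (iii) On $\mathcal S$, $\Delta_g$ is one half of the Laplace–Beltrami operator of the metric $g=\frac1{1-\rho^2}\Bigl(\frac{dx^2}{y^2x^{2\beta}}-\frac{2\rho\,dx\,dy}{y^2x^\beta}+\frac{dy^2}{y^2}\Bigr)$. For all $f_1,f_2\in C_0^\infty(\mathcal S)$ one has $(\Delta_gf_1,f_2)_{\mathcal H_0}=-\mathcal E_{m_0}(f_1,f_2)$; and if $\beta<1$, then $f_1\in D(\Phi(\mathcal E_{m_0}))$, $\Phi(\mathcal E_{m_0})f_1=\Delta_gf_1$ and $$(\Phi(\mathcal E_{m_0})f_1,f_2)_{\mathcal H_0}=(\Delta_gf_1,f_2)_{\mathcal H_0}=-\mathcal E_{m_0}(f_1,f_2).$$ If $\beta=0$, the same holds with $A$ in place of $\Delta_g$. (iv) If $\rho=0$, then $(Af_1,f_2)_{\mathcal H_1}=-\mathcal E_{m_1}(f_1,f_2)$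 for all $f_1,f_2\in C_0^\infty(\mathcal S)$; and if moreover $\beta<1/2$, then $f_1\in D(\Phi(\mathcal E_{m_1}))$, $\Phi(\mathcal E_{m_1})f_1=Af_1$ and $$(\Phi(\mathcal E_{m_1})f_1,f_2)_{\mathcal H_1}=(Af_1,f_2)_{\mathcal H_1}=-\mathcal E_{m_1}(f_1,f_2).$$ -/

import Mathlib

open MeasureTheory Set Filter Topology
open scoped ENNReal ContDiff

noncomputable section

namespace SABR

/-! ### Symmetric, closed, closable forms and their generators on a real Hilbert space -/

section Forms

variable {H : Type*} [NormedAddCommGroup H] [InnerProductSpace ℝ H]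

/-- `(E, D)` is a symmetric form on `H`: `D` is a dense linear subspace and `E` is bilinear,
symmetric and nonnegative on `D`. The values of `E` outside `D` play no role. -/
structure IsSymmetricForm (D : Set H) (E : H → H → ℝ) : Prop where
  zero_mem : (0 : H) ∈ D
  add_mem : ∀ u ∈ D, ∀ v ∈ D, u + v ∈ D
  smul_mem : ∀ (c : ℝ), ∀ u ∈ D, c • u ∈ D
  dense : Dense D
  add_left : ∀ u₁ ∈ D, ∀ u₂ ∈ D, ∀ v ∈ D, E (u₁ + u₂) v = E u₁ v + E u₂ v
  smul_left : ∀ (c : ℝ), ∀ u ∈ D, ∀ v ∈ D, E (c • u) v = c * E u v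
  symm : ∀ u ∈ D, ∀ v ∈ D, E u v = E v u
  nonneg : ∀ u ∈ D, 0 ≤ E u u

/-- The square of the norm `‖u‖_{E₁} = (E(u,u) + ‖u‖²)^{1/2}`. -/
def normE1Sq (E : H → H → ℝ) (u : H) : ℝ := E u u + ‖u‖ ^ 2

/-- A closed form: a symmetric form whose domain is complete for the norm `‖·‖_{E₁}`. -/
structure IsClosedForm (D : Set H) (E : H → H → ℝ) : Prop extends IsSymmetricForm D E where
  complete : ∀ u : ℕ → H, (∀ n, u n ∈ D) →
    (∀ ε > 0, ∃ N, ∀ m ≥ N, ∀ n ≥ N, normE1Sq E (u m - u n) < ε) →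
    ∃ v ∈ D, Tendsto (fun n => normE1Sq E (u n - v)) atTop (𝓝 0)

/-- A form is closable if it has a closed extension. -/
def IsClosable (D : Set H) (E : H → H → ℝ) : Prop :=
  ∃ (D' : Set H) (E' : H → H → ℝ), IsClosedForm D' E' ∧ D ⊆ D' ∧
    ∀ u ∈ D, ∀ v ∈ D, E' u v = E u v

/-- The domain of the generator of the form `(E, D)`: those `u ∈ D` for which there is `w ∈ H`
with `E(u,v) = -(w,v)` for all `v ∈ D`. -/
def generatorDomain (D : Set H) (E : H → H → ℝ) : Set H :=
  {u | u ∈ D ∧ ∃ w : H, ∀ v ∈ D, E u v = -inner ℝ w v}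

/-- The generator of the form `(E, D)`: for `u` in its domain, the element `w` of `H` with
`E(u,v) = -(w,v)` for all `v ∈ D` (unique, since `D` is dense). -/
def generator (D : Set H) (E : H → H → ℝ) (u : H) : H :=
  Classical.epsilon fun w : H => ∀ v ∈ D, E u v = -inner ℝ w v

end Forms

/-- A Dirichlet form on `L²(μ)`: a closed form that is Markovian, i.e. for every `u ∈ D` also
`u⁺ ∧ 1 ∈ D` and `E(u⁺ ∧ 1, u⁺ ∧ 1) ≤ E(u,u)`. -/
structure IsDirichletForm {α : Type*} [MeasurableSpace α] {μ : Measure α}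
    (D : Set (Lp ℝ 2 μ)) (E : Lp ℝ 2 μ → Lp ℝ 2 μ → ℝ) : Prop extends IsClosedForm D E where
  markov : ∀ u ∈ D, ∃ w ∈ D, (w =ᵐ[μ] fun p => min (max (u p) 0) 1) ∧ E w w ≤ E u u

/-! ### Absolutely continuous versions -/

/-- `w` is (locally) absolutely continuous on `I`: absolutely continuous on every compact
interval contained in `I`. -/
def LocallyAC (I : Set ℝ) (w : ℝ → ℝ) : Prop :=
  ∀ a b : ℝ, uIcc a b ⊆ I → AbsolutelyContinuousOnInterval w a b

/-- `w` is an absolutely continuous version of `h` on `I`. -/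
def IsACVersion (I : Set ℝ) (h w : ℝ → ℝ) : Prop :=
  LocallyAC I w ∧ h =ᵐ[volume.restrict I] w

/-- The absolutely continuous version of `h` on `I` (an arbitrary function if there is none).
On an open interval `I` it is unique as a function on `I`, since it is continuous there. -/
def acVersion (I : Set ℝ) (h : ℝ → ℝ) : ℝ → ℝ :=
  Classical.epsilon (IsACVersion I h)

/-! ### The weighted spaces and the energy form -/

/-- The half-plane `S = ℝ × (0,∞)`. -/
def halfPlane : Set (ℝ × ℝ) := {p | 0 < p.2}

/-- The open quadrant `𝒮 = (0,∞)²`. -/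
def quadrant : Set (ℝ × ℝ) := {p | 0 < p.1 ∧ 0 < p.2}

/-- `f ∈ C_0^∞(U)`, for `U` open: smooth with compact support in `U` (extended by zero). -/
def IsTest (U : Set (ℝ × ℝ)) (f : ℝ × ℝ → ℝ) : Prop :=
  ContDiff ℝ ∞ f ∧ HasCompactSupport f ∧ tsupport f ⊆ U

/-- The measure `m_j(x,y) dx dy` on `S`, with `m_j = 1 / (ρ̄ |x|^{β(1+j)} y²)`,
`ρ̄ = √(1-ρ²)`. -/
def speedMeasure (ρ β : ℝ) (j : ℕ) : Measure (ℝ × ℝ) :=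
  (volume.restrict halfPlane).withDensity fun p =>
    ENNReal.ofReal (1 / (√(1 - ρ ^ 2) * |p.1| ^ (β * (1 + j)) * p.2 ^ 2))

/-- The weighted space `H_j = L²(S, m_j(x,y) dx dy)`. -/
abbrev HilbertL2 (ρ β : ℝ) (j : ℕ) := Lp ℝ 2 (speedMeasure ρ β j)

/-- The symmetric bilinear expression
`y² (x^{2β} a₁ b₁ + ρ x^β (a₁ b₂ + a₂ b₁) + a₂ b₂)` in two gradients `a`, `b` at `p = (x,y)`,
with `x^β` read as `|x|^β`. -/
def gammaGrad (ρ β : ℝ) (p a b : ℝ × ℝ) : ℝ :=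
  p.2 ^ 2 * (|p.1| ^ (2 * β) * a.1 * b.1 + ρ * |p.1| ^ β * (a.1 * b.2 + a.2 * b.1) + a.2 * b.2)

/-- Classical partial derivative in `x`. -/
def partialX (f : ℝ × ℝ → ℝ) (p : ℝ × ℝ) : ℝ := deriv (fun s => f (s, p.2)) p.1

/-- Classical partial derivative in `y`. -/
def partialY (f : ℝ × ℝ → ℝ) (p : ℝ × ℝ) : ℝ := deriv (fun t => f (p.1, t)) p.2

/-- `Γ(f₁,f₂)` for smooth functions. -/
def gammaSmooth (ρ β : ℝ) (f₁ f₂ : ℝ × ℝ → ℝ) (p : ℝ × ℝ) : ℝ :=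
  gammaGrad ρ β p (partialX f₁ p, partialY f₁ p) (partialX f₂ p, partialY f₂ p)

/-- The gradient of `u` on `S`, formed with the derivatives of the absolutely continuous
versions of `x ↦ u(x,ȳ)` on `ℝ` and of `y ↦ u(x̄,y)` on `(0,∞)`. -/
def acGradient (u : ℝ × ℝ → ℝ) (p : ℝ × ℝ) : ℝ × ℝ :=
  (deriv (acVersion univ fun s => u (s, p.2)) p.1,
   deriv (acVersion (Ioi 0) fun t => u (p.1, t)) p.2)

/-- `Γ(u,v)` for functions with absolutely continuous versions on lines. -/
def gammaAC (ρ β : ℝ) (u v : ℝ × ℝ → ℝ) (p : ℝ × ℝ) : ℝ :=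
  gammaGrad ρ β p (acGradient u p) (acGradient v p)

/-- The energy form `E_{m_j}(u,v) = ½ ∫_S Γ(u,v) m_j dx dy`. -/
def energy (ρ β : ℝ) (j : ℕ) (u v : HilbertL2 ρ β j) : ℝ :=
  (1 / 2) * ∫ p, gammaAC ρ β u v p ∂(speedMeasure ρ β j)

/-- The domain `D(E_{m_j})`: the `u ∈ H_j` that have absolutely continuous versions on almost
all lines parallel to the axes and satisfy `Γ(u,u) ∈ L¹(S, m_j dx dy)`. -/
def energyDomain (ρ β : ℝ) (j : ℕ) : Set (HilbertL2 ρ β j) :=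
  {u | (∀ᵐ y ∂(volume.restrict (Ioi (0 : ℝ))), ∃ w, IsACVersion univ (fun s => u (s, y)) w) ∧
    (∀ᵐ x ∂(volume : Measure ℝ), ∃ w, IsACVersion (Ioi 0) (fun t => u (x, t)) w) ∧
    Integrable (gammaAC ρ β u u) (speedMeasure ρ β j)}

/-- `C_0^∞(S)` as a set of elements of `H_j`. -/
def testDomain (ρ β : ℝ) (j : ℕ) : Set (HilbertL2 ρ β j) :=
  {u | ∃ f, IsTest halfPlane f ∧ u =ᵐ[speedMeasure ρ β j] f}

/-! ### The differential operators -/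

/-- The SABR generator `A f = ½ y² (x^{2β} f_xx + 2ρ x^β f_xy + f_yy)`. -/
def sabrGenerator (ρ β : ℝ) (f : ℝ × ℝ → ℝ) (p : ℝ × ℝ) : ℝ :=
  (1 / 2) * p.2 ^ 2 * (p.1 ^ (2 * β) * partialX (partialX f) p
    + 2 * ρ * p.1 ^ β * partialX (partialY f) p + partialY (partialY f) p)

/-- The operator `Δ_g f = (β/2) y² x^{2β-1} f_x + A f`. -/
def sabrLaplace (ρ β : ℝ) (f : ℝ × ℝ → ℝ) (p : ℝ × ℝ) : ℝ :=
  β / 2 * p.2 ^ 2 * p.1 ^ (2 * β - 1) * partialX f p + sabrGenerator ρ β f p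

/-- The SABR metric
`g = (1-ρ²)⁻¹ (dx²/(y² x^{2β}) - 2ρ dx dy/(y² x^β) + dy²/y²)` on `(0,∞)²`. -/
def sabrMetric (ρ β : ℝ) (p : ℝ × ℝ) : Matrix (Fin 2) (Fin 2) ℝ :=
  (1 / (1 - ρ ^ 2)) •
    !![1 / (p.2 ^ 2 * p.1 ^ (2 * β)), -ρ / (p.2 ^ 2 * p.1 ^ β);
       -ρ / (p.2 ^ 2 * p.1 ^ β), 1 / p.2 ^ 2]

/-- The Laplace–Beltrami operator of a metric `g` in the coordinates `(x,y)`: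
`(det g)^{-1/2} ∑ᵢ ∂ᵢ ((det g)^{1/2} ∑ₖ g^{ik} ∂ₖ f)`. -/
def laplaceBeltrami (g : ℝ × ℝ → Matrix (Fin 2) (Fin 2) ℝ) (f : ℝ × ℝ → ℝ) (p : ℝ × ℝ) : ℝ :=
  (√(g p).det)⁻¹ *
    (partialX (fun q => √(g q).det * ((g q)⁻¹ 0 0 * partialX f q + (g q)⁻¹ 0 1 * partialY f q)) p
    + partialY (fun q => √(g q).det *
        ((g q)⁻¹ 1 0 * partialX f q + (g q)⁻¹ 1 1 * partialY f q)) p)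

/-- The generator of `(E_{m_j}, D(E_{m_j}))` is defined on `C_0^∞((0,∞)²)`, agrees there with
the operator `L`, and `(Φ f₁, f₂) = (L f₁, f₂) = -E_{m_j}(f₁, f₂)`, the scalar products being
those of `H_j`. -/
def GeneratorAgrees (ρ β : ℝ) (j : ℕ) (L : (ℝ × ℝ → ℝ) → ℝ × ℝ → ℝ) : Prop :=
  ∀ f₁, IsTest quadrant f₁ → ∀ u₁ : HilbertL2 ρ β j, u₁ =ᵐ[speedMeasure ρ β j] f₁ →
    u₁ ∈ generatorDomain (energyDomain ρ β j) (energy ρ β j) ∧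
    (generator (energyDomain ρ β j) (energy ρ β j) u₁ : HilbertL2 ρ β j)
      =ᵐ[speedMeasure ρ β j] L f₁ ∧
    ∀ f₂, IsTest quadrant f₂ → ∀ u₂ : HilbertL2 ρ β j, u₂ =ᵐ[speedMeasure ρ β j] f₂ →
      inner ℝ (generator (energyDomain ρ β j) (energy ρ β j) u₁) u₂
        = ∫ p, L f₁ p * f₂ p ∂(speedMeasure ρ β j) ∧
      ∫ p, L f₁ p * f₂ p ∂(speedMeasure ρ β j) = -energy ρ β j u₁ u₂

/-- Integration by parts: `(L f₁, f₂) = -½ ∫_S Γ(f₁,f₂) m_j dx dy` for `f₁, f₂` in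
`C_0^∞((0,∞)²)`. -/
def FormIdentity (ρ β : ℝ) (j : ℕ) (L : (ℝ × ℝ → ℝ) → ℝ × ℝ → ℝ) : Prop :=
  ∀ f₁ f₂, IsTest quadrant f₁ → IsTest quadrant f₂ →
    ∫ p, L f₁ p * f₂ p ∂(speedMeasure ρ β j)
      = -((1 / 2) * ∫ p, gammaSmooth ρ β f₁ f₂ p ∂(speedMeasure ρ β j))

end SABR

end

noncomputable section

namespace SABR

section

/-! ### Primitives on a line -/

/-- An open order-connected upper set of reals containing `1`. -/
structure IsLineSet (I : Set ℝ) : Prop where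
  isOpen : IsOpen I
  isUpper : IsUpperSet I
  one_mem : (1 : ℝ) ∈ I

lemma isLineSet_univ : IsLineSet univ := ⟨isOpen_univ, isUpperSet_univ, mem_univ _⟩

lemma isLineSet_Ioi : IsLineSet (Ioi 0) := ⟨isOpen_Ioi, isUpperSet_Ioi 0, by simp⟩

lemma IsLineSet.uIcc_subset {I : Set ℝ} (hI : IsLineSet I) {a b : ℝ} (ha : a ∈ I) (hb : b ∈ I) :
    uIcc a b ⊆ I := hI.isUpper.ordConnected.uIcc_subset ha hb

lemma IsLineSet.measurableSet {I : Set ℝ} (hI : IsLineSet I) : MeasurableSet I :=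
  hI.isOpen.measurableSet

/-- A property that holds a.e. on the compact intervals of `I` holds a.e. on `I`. -/
lemma IsLineSet.ae_of_uIcc {I : Set ℝ} (hI : IsLineSet I) {p : ℝ → Prop}
    (h : ∀ a b, uIcc a b ⊆ I → ∀ᵐ x, x ∈ uIcc a b → p x) :
    ∀ᵐ x ∂(volume.restrict I), p x := by
  rw [ae_restrict_iff' hI.measurableSet]
  have h' : ∀ᵐ x : ℝ, ∀ q : ℚ × ℚ, uIcc (q.1 : ℝ) q.2 ⊆ I → x ∈ uIcc (q.1 : ℝ) q.2 → p x := by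
    rw [ae_all_iff]
    intro q
    by_cases hq : uIcc (q.1 : ℝ) q.2 ⊆ I
    · filter_upwards [h _ _ hq] with x hx _ using hx
    · exact Eventually.of_forall fun x h1 => absurd h1 hq
  filter_upwards [h'] with x hx hxI
  obtain ⟨ε, hε, hball⟩ := Metric.isOpen_iff.1 hI.isOpen x hxI
  obtain ⟨a, ha1, ha2⟩ := exists_rat_btwn (show x - ε < x by linarith)
  obtain ⟨b, hb1, hb2⟩ := exists_rat_btwn (show x < x + ε by linarith)
  have haI : (a : ℝ) ∈ I := hball (by rw [Metric.mem_ball, Real.dist_eq, abs_lt]; constructor <;> linarith)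
  have hbI : (b : ℝ) ∈ I := hball (by rw [Metric.mem_ball, Real.dist_eq, abs_lt]; constructor <;> linarith)
  exact hx (a, b) (hI.uIcc_subset haI hbI) (by rw [mem_uIcc]; left; constructor <;> linarith)

/-- `h` agrees a.e. on `I` with a primitive of the locally integrable function `k`. -/
def IsPrimitiveAE (I : Set ℝ) (h k : ℝ → ℝ) : Prop :=
  (∀ a b : ℝ, uIcc a b ⊆ I → IntervalIntegrable k volume a b) ∧
    ∃ c : ℝ, h =ᵐ[volume.restrict I] fun t => c + ∫ s in (1 : ℝ)..t, k s

variable {I : Set ℝ} {h h' k k' w w' : ℝ → ℝ}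

lemma IsPrimitiveAE.congr (H : IsPrimitiveAE I h k) (hh : h =ᵐ[volume.restrict I] h') :
    IsPrimitiveAE I h' k :=
  ⟨H.1, H.2.imp fun _ hc => hh.symm.trans hc⟩

lemma absolutelyContinuousOnInterval_const (c a b : ℝ) :
    AbsolutelyContinuousOnInterval (fun _ => c) a b :=
  (LipschitzWith.const c).lipschitzOnWith.absolutelyContinuousOnInterval

lemma locallyAC_primitive (hI : IsLineSet I)
    (hk : ∀ a b : ℝ, uIcc a b ⊆ I → IntervalIntegrable k volume a b) (c : ℝ) :
    LocallyAC I fun t => c + ∫ s in (1 : ℝ)..t, k s := by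
  intro a b hab
  have haI : a ∈ I := hab left_mem_uIcc
  have hbI : b ∈ I := hab right_mem_uIcc
  have hm : min (min a b) 1 ∈ I := by
    rcases min_choice (min a b) 1 with h | h <;> rw [h]
    · rcases min_choice a b with h | h <;> rw [h] <;> assumption
    · exact hI.one_mem
  have hM : max (max a b) 1 ∈ I := hI.isUpper (le_max_right _ _) hI.one_mem
  have h1 := (hk _ _ (hI.uIcc_subset hm hM)).absolutelyContinuousOnInterval_intervalIntegral
    (c := 1) (by
      rw [mem_uIcc]; left; exact ⟨min_le_right _ _, le_max_right _ _⟩)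
  refine ((absolutelyContinuousOnInterval_const c _ _).add h1).mono ?_
  rw [uIcc_of_le (show min (min a b) 1 ≤ max (max a b) 1 from
    (min_le_right _ _).trans (le_max_right _ _))]
  exact Icc_subset_Icc (min_le_left _ _) (le_max_left _ _)

lemma IsPrimitiveAE.exists_isACVersion (hI : IsLineSet I) (H : IsPrimitiveAE I h k) :
    ∃ c : ℝ, IsACVersion I h fun t => c + ∫ s in (1 : ℝ)..t, k s :=
  H.2.imp fun c hc => ⟨locallyAC_primitive hI H.1 c, hc⟩

lemma LocallyAC.continuousOn (hI : IsLineSet I) (hw : LocallyAC I w) : ContinuousOn w I := by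
  intro x hx
  obtain ⟨ε, hε, hball⟩ := Metric.isOpen_iff.1 hI.isOpen x hx
  have hsub : uIcc (x - ε / 2) (x + ε / 2) ⊆ I := by
    apply hI.uIcc_subset <;> apply hball <;> rw [Metric.mem_ball, Real.dist_eq, abs_lt] <;>
      constructor <;> linarith
  refine ((hw _ _ hsub).continuousOn.continuousAt ?_).continuousWithinAt
  rw [uIcc_of_le (by linarith)]
  exact Icc_mem_nhds (by linarith) (by linarith)

lemma LocallyAC.ae_differentiableAt (hI : IsLineSet I) (hw : LocallyAC I w) :
    ∀ᵐ x ∂(volume.restrict I), DifferentiableAt ℝ w x :=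
  hI.ae_of_uIcc fun a b hab => (hw a b hab).ae_differentiableAt

lemma IsACVersion.isPrimitiveAE (hI : IsLineSet I) (hw : IsACVersion I h w) :
    IsPrimitiveAE I h (deriv w) := by
  refine ⟨fun a b hab => (hw.1 a b hab).intervalIntegrable_deriv, w 1, hw.2.trans ?_⟩
  filter_upwards [ae_restrict_mem hI.measurableSet] with t ht
  rw [(hw.1 1 t (hI.uIcc_subset hI.one_mem ht)).integral_deriv_eq_sub]
  ring

lemma IsACVersion.eqOn (hI : IsLineSet I) (hw : IsACVersion I h w) (hw' : IsACVersion I h w') :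
    EqOn w w' I :=
  Measure.eqOn_open_of_ae_eq (hw.2.symm.trans hw'.2) hI.isOpen (hw.1.continuousOn hI)
    (hw'.1.continuousOn hI)

lemma isACVersion_acVersion (hw : ∃ w, IsACVersion I h w) : IsACVersion I h (acVersion I h) :=
  Classical.epsilon_spec hw

lemma IsPrimitiveAE.isACVersion_acVersion (hI : IsLineSet I) (H : IsPrimitiveAE I h k) :
    IsACVersion I h (acVersion I h) :=
  SABR.isACVersion_acVersion (let ⟨_, hc⟩ := H.exists_isACVersion hI; ⟨_, hc⟩)

lemma IsPrimitiveAE.deriv_acVersion (hI : IsLineSet I) (H : IsPrimitiveAE I h k) {t : ℝ}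
    (ht : t ∈ I) (hd : HasDerivAt (fun x => ∫ s in (1 : ℝ)..x, k s) (k t) t) :
    deriv (acVersion I h) t = k t := by
  obtain ⟨c, hc⟩ := H.exists_isACVersion hI
  have he := (H.isACVersion_acVersion hI).eqOn hI hc
  have : acVersion I h =ᶠ[𝓝 t] fun t => c + ∫ s in (1 : ℝ)..t, k s :=
    he.eventuallyEq_of_mem (hI.isOpen.mem_nhds ht)
  rw [this.deriv_eq]
  exact (hd.const_add c).deriv

lemma ae_hasDerivAt_primitive (hI : IsLineSet I)
    (hk : ∀ a b : ℝ, uIcc a b ⊆ I → IntervalIntegrable k volume a b) :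
    ∀ᵐ t ∂(volume.restrict I), HasDerivAt (fun x => ∫ s in (1 : ℝ)..x, k s) (k t) t := by
  refine hI.ae_of_uIcc fun a b hab => ?_
  have haI : a ∈ I := hab left_mem_uIcc
  have hbI : b ∈ I := hab right_mem_uIcc
  have hm : min (min a b) 1 ∈ I := by
    rcases min_choice (min a b) 1 with h | h <;> rw [h]
    · rcases min_choice a b with h | h <;> rw [h] <;> assumption
    · exact hI.one_mem
  have hM : max (max a b) 1 ∈ I := hI.isUpper (le_max_right _ _) hI.one_mem
  have hle : min (min a b) 1 ≤ max (max a b) 1 := (min_le_right _ _).trans (le_max_right _ _)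
  filter_upwards [(hk _ _ (hI.uIcc_subset hm hM)).ae_hasDerivAt_integral] with x hx hxab
  rw [uIcc_of_le hle] at hx
  exact hx (Icc_subset_Icc (min_le_left _ _) (le_max_left _ _) hxab) 1
    ⟨min_le_right _ _, le_max_right _ _⟩

lemma IsPrimitiveAE.ae_deriv_eq (hI : IsLineSet I) (H : IsPrimitiveAE I h k)
    (hw : IsACVersion I h w) : ∀ᵐ t ∂(volume.restrict I), HasDerivAt w (k t) t := by
  obtain ⟨c, hc⟩ := H.exists_isACVersion hI
  filter_upwards [ae_hasDerivAt_primitive hI H.1, ae_restrict_mem hI.measurableSet] with t h1 ht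
  exact (h1.const_add c).congr_of_eventuallyEq
    ((hw.eqOn hI hc).eventuallyEq_of_mem (hI.isOpen.mem_nhds ht))

lemma IsPrimitiveAE.congr_deriv (hI : IsLineSet I) (H : IsPrimitiveAE I h k)
    (hk : k =ᵐ[volume.restrict I] k') : IsPrimitiveAE I h k' := by
  have hsub : ∀ a b : ℝ, uIcc a b ⊆ I → k =ᵐ[volume.restrict (uIoc a b)] k' := fun a b hab =>
    ae_restrict_of_ae_restrict_of_subset (uIoc_subset_uIcc.trans hab) hk
  refine ⟨fun a b hab => (H.1 a b hab).congr_ae (hsub a b hab), H.2.imp fun c hc => hc.trans ?_⟩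
  filter_upwards [ae_restrict_mem hI.measurableSet] with t ht
  congr 1
  refine intervalIntegral.integral_congr_ae ?_
  exact (ae_restrict_iff' measurableSet_uIoc).1 (hsub 1 t (hI.uIcc_subset hI.one_mem ht))

lemma IsPrimitiveAE.add (hI : IsLineSet I) (H : IsPrimitiveAE I h k) (H' : IsPrimitiveAE I h' k') :
    IsPrimitiveAE I (fun t => h t + h' t) (fun t => k t + k' t) := by
  obtain ⟨c, hc⟩ := H.2
  obtain ⟨c', hc'⟩ := H'.2
  refine ⟨fun a b hab => (H.1 a b hab).add (H'.1 a b hab), c + c', ?_⟩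
  filter_upwards [hc, hc', ae_restrict_mem hI.measurableSet] with t h1 h2 ht
  have hs := hI.uIcc_subset hI.one_mem ht
  rw [intervalIntegral.integral_add (H.1 _ _ hs) (H'.1 _ _ hs), h1, h2]
  ring

lemma IsPrimitiveAE.const_mul (c : ℝ) (H : IsPrimitiveAE I h k) :
    IsPrimitiveAE I (fun t => c * h t) (fun t => c * k t) := by
  obtain ⟨d, hd⟩ := H.2
  refine ⟨fun a b hab => (H.1 a b hab).const_mul c, c * d, ?_⟩
  filter_upwards [hd] with t h1
  rw [intervalIntegral.integral_const_mul, h1]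
  ring

lemma isPrimitiveAE_of_contDiff (hI : IsLineSet I) {f : ℝ → ℝ} (hf : ContDiff ℝ 1 f) :
    IsPrimitiveAE I f (deriv f) :=
  IsACVersion.isPrimitiveAE hI
    ⟨fun _ _ _ => hf.contDiffOn.absolutelyContinuousOnInterval, EventuallyEq.rfl⟩

lemma LocallyAC.comp_lipschitz {φ : ℝ → ℝ} (hφ : LipschitzWith 1 φ) (hw : LocallyAC I w) :
    LocallyAC I fun t => φ (w t) := by
  intro a b hab
  have := hw a b hab
  rw [absolutelyContinuousOnInterval_iff] at this ⊢
  intro ε hε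
  obtain ⟨δ, hδ, h⟩ := this ε hε
  refine ⟨δ, hδ, fun E hE hEδ => lt_of_le_of_lt (Finset.sum_le_sum fun i _ => ?_) (h E hE hEδ)⟩
  simpa using hφ.dist_le_mul (w (E.2 i).1) (w (E.2 i).2)

/-- The unit contraction `t ↦ t⁺ ∧ 1`. -/
def unitClamp (t : ℝ) : ℝ := min (max t 0) 1

lemma lipschitzWith_unitClamp : LipschitzWith 1 unitClamp := by
  have := (LipschitzWith.id (α := ℝ)).max_const 0
  exact this.min_const 1

lemma unitClamp_nonneg (t : ℝ) : 0 ≤ unitClamp t := le_min (le_max_right _ _) zero_le_one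

lemma unitClamp_le_one (t : ℝ) : unitClamp t ≤ 1 := min_le_right _ _

lemma unitClamp_of_mem {t : ℝ} (ht : t ∈ Ioo (0 : ℝ) 1) : unitClamp t = t := by
  rw [unitClamp, max_eq_left ht.1.le, min_eq_left ht.2.le]

lemma deriv_unitClamp_comp {t : ℝ} (hw : DifferentiableAt ℝ w t) :
    deriv (fun s => unitClamp (w s)) t = (Ioo (0 : ℝ) 1).indicator 1 (w t) * deriv w t := by
  by_cases hmem : w t ∈ Ioo (0 : ℝ) 1
  · rw [indicator_of_mem hmem, Pi.one_apply, one_mul]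
    refine EventuallyEq.deriv_eq ?_
    filter_upwards [hw.continuousAt.preimage_mem_nhds (isOpen_Ioo.mem_nhds hmem)] with s hs
    exact unitClamp_of_mem hs
  · rw [indicator_of_notMem hmem, zero_mul]
    rcases le_or_gt (w t) 0 with h0 | h0
    · refine IsLocalMin.deriv_eq_zero (Eventually.of_forall fun s => ?_)
      have : unitClamp (w t) = 0 := by
        rw [unitClamp, max_eq_right h0, min_eq_left zero_le_one]
      change SABR.unitClamp (w t) ≤ _
      rw [this]
      exact unitClamp_nonneg _
    · have h1 : 1 ≤ w t := by
        by_contra hcon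
        exact hmem ⟨h0, not_le.1 hcon⟩
      refine IsLocalMax.deriv_eq_zero (Eventually.of_forall fun s => ?_)
      have : unitClamp (w t) = 1 := by
        rw [unitClamp, min_eq_right (h1.trans (le_max_left _ _))]
      change _ ≤ SABR.unitClamp (w t)
      rw [this]
      exact unitClamp_le_one _

lemma IsPrimitiveAE.unitClamp (hI : IsLineSet I) (H : IsPrimitiveAE I h k) :
    IsPrimitiveAE I (fun t => unitClamp (h t))
      (fun t => (Ioo (0 : ℝ) 1).indicator 1 (h t) * k t) := by
  obtain ⟨c, hw⟩ := H.exists_isACVersion hI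
  set w := fun t => c + ∫ s in (1 : ℝ)..t, k s
  have hv : IsACVersion I (fun t => SABR.unitClamp (h t)) fun t => SABR.unitClamp (w t) :=
    ⟨hw.1.comp_lipschitz lipschitzWith_unitClamp, hw.2.fun_comp SABR.unitClamp⟩
  refine (hv.isPrimitiveAE hI).congr_deriv hI ?_
  filter_upwards [H.ae_deriv_eq hI hw, hw.2] with t h1 h2
  rw [deriv_unitClamp_comp h1.differentiableAt, h1.deriv, h2]

/-- Difference quotients of a function with an absolutely continuous version converge a.e. -/
lemma IsACVersion.ae_tendsto_slope (hI : IsLineSet I) (hw : IsACVersion I h w) :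
    ∀ᵐ t ∂(volume.restrict I), Tendsto
      (fun n : ℕ => ((n : ℝ) + 1) * (h (t + ((n : ℝ) + 1)⁻¹) - h t)) atTop (𝓝 (deriv w t)) := by
  have hshift : ∀ᵐ t ∂(volume.restrict I), ∀ n : ℕ,
      h (t + ((n : ℝ) + 1)⁻¹) = w (t + ((n : ℝ) + 1)⁻¹) := by
    rw [ae_all_iff]
    intro n
    have h1 := (ae_restrict_iff' hI.measurableSet).1 hw.2
    have h2 := (measurePreserving_add_right (volume : Measure ℝ)
      ((n : ℝ) + 1)⁻¹).quasiMeasurePreserving.ae h1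
    rw [ae_restrict_iff' hI.measurableSet]
    filter_upwards [h2] with t ht htI
    exact ht (hI.isUpper (by simp; positivity) htI)
  filter_upwards [hshift, hw.2, hw.1.ae_differentiableAt hI] with t h1 h2 h3
  simp_rw [h1, h2]
  have := (hasDerivAt_iff_tendsto_slope_zero.1 h3.hasDerivAt)
  have hn : Tendsto (fun n : ℕ => ((n : ℝ) + 1)⁻¹) atTop (𝓝[≠] 0) := by
    refine tendsto_nhdsWithin_iff.2 ⟨?_, Eventually.of_forall fun n => ?_⟩
    · simpa using tendsto_one_div_add_atTop_nhds_zero_nat (𝕜 := ℝ)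
    · have : ((n : ℝ) + 1)⁻¹ ≠ 0 := by positivity
      exact this
  simpa [Function.comp_def] using this.comp hn

end

section

variable {I : Set ℝ} {h k : ℝ → ℝ}

lemma IsLineSet.ae_restrict_neBot (hI : IsLineSet I) : (ae (volume.restrict I : Measure ℝ)).NeBot := by
  rw [ae_neBot]
  intro h0
  rw [Measure.restrict_eq_zero] at h0
  exact (hI.isOpen.measure_pos volume ⟨1, hI.one_mem⟩).ne' h0

/-- Primitives are stable under a.e. convergence when the derivatives converge locally in `L¹`. -/
lemma isPrimitiveAE_of_tendsto (hI : IsLineSet I) {hn kn : ℕ → ℝ → ℝ}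
    (Hn : ∀ n, IsPrimitiveAE I (hn n) (kn n)) (hk : Measurable k)
    (hh : ∀ᵐ t ∂(volume.restrict I), Tendsto (fun n => hn n t) atTop (𝓝 (h t)))
    (hkn : ∀ a b : ℝ, uIcc a b ⊆ I →
      Tendsto (fun n => ∫⁻ t in uIcc a b, ‖kn n t - k t‖ₑ) atTop (𝓝 0)) :
    IsPrimitiveAE I h k := by
  have hloc : ∀ a b : ℝ, uIcc a b ⊆ I →
      Tendsto (fun n => ∫⁻ t in uIoc a b, ‖kn n t - k t‖ₑ) atTop (𝓝 0) := fun a b hab =>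
    tendsto_of_tendsto_of_tendsto_of_le_of_le tendsto_const_nhds (hkn a b hab)
      (fun _ => zero_le) fun n => lintegral_mono_set uIoc_subset_uIcc
  have hint : ∀ a b : ℝ, uIcc a b ⊆ I → IntervalIntegrable k volume a b := by
    intro a b hab
    obtain ⟨n, hn⟩ := ((hloc a b hab).eventually (gt_mem_nhds ENNReal.zero_lt_top)).exists
    have h1 := intervalIntegrable_iff.1 ((Hn n).1 a b hab)
    have h2 : IntegrableOn (fun t => kn n t - k t) (uIoc a b) :=
      ⟨h1.aestronglyMeasurable.sub hk.aestronglyMeasurable, hn⟩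
    rw [intervalIntegrable_iff]
    refine (h1.sub h2).congr (Eventually.of_forall fun t => ?_)
    simp
  have hlim : ∀ t ∈ I, Tendsto (fun n => ∫ s in (1 : ℝ)..t, kn n s) atTop
      (𝓝 (∫ s in (1 : ℝ)..t, k s)) := by
    intro t ht
    have hs := hI.uIcc_subset hI.one_mem ht
    simp_rw [intervalIntegral.intervalIntegral_eq_integral_uIoc]
    refine Tendsto.const_smul ?_ _
    exact tendsto_integral_of_L1 k hk.aestronglyMeasurable
      (Eventually.of_forall fun n => intervalIntegrable_iff.1 ((Hn n).1 1 t hs)) (hloc 1 t hs)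
  choose c hc using fun n => (Hn n).2
  have hall : ∀ᵐ t ∂(volume.restrict I), ∀ n, hn n t = c n + ∫ s in (1 : ℝ)..t, kn n s :=
    ae_all_iff.2 hc
  have := hI.ae_restrict_neBot
  obtain ⟨t₀, h1, h2, h3⟩ :=
    ((hall.and (hh.and (ae_restrict_mem hI.measurableSet))).exists : ∃ t, _)
  have hclim : Tendsto c atTop (𝓝 (h t₀ - ∫ s in (1 : ℝ)..t₀, k s)) := by
    refine (h2.sub (hlim t₀ h3)).congr fun n => ?_
    rw [h1 n]
    ring
  refine ⟨hint, h t₀ - ∫ s in (1 : ℝ)..t₀, k s, ?_⟩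
  filter_upwards [hall, hh, ae_restrict_mem hI.measurableSet] with t h4 h5 h6
  refine tendsto_nhds_unique h5 ((hclim.add (hlim t h6)).congr fun n => ?_)
  rw [h4 n]

/-- Weighted Cauchy–Schwarz. -/
lemma lintegral_enorm_le_weighted {α : Type*} [MeasurableSpace α] {μ : Measure α} {d : α → ℝ}
    {W : α → ℝ≥0∞} (hd : AEMeasurable d μ) (hW : AEMeasurable W μ)
    (hW0 : ∀ᵐ t ∂μ, W t ≠ 0) (hWt : ∀ᵐ t ∂μ, W t ≠ ⊤) :
    ∫⁻ t, ‖d t‖ₑ ∂μ ≤ (∫⁻ t, ‖d t‖ₑ ^ 2 * W t ∂μ) ^ (1 / 2 : ℝ) * (∫⁻ t, (W t)⁻¹ ∂μ) ^ (1 / 2 : ℝ) := by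
  have h1 := ENNReal.lintegral_mul_le_Lp_mul_Lq μ (p := 2) (q := 2)
    (by constructor <;> norm_num)
    (f := fun t => ‖d t‖ₑ * W t ^ (1 / 2 : ℝ)) (g := fun t => (W t ^ (1 / 2 : ℝ))⁻¹)
    (hd.enorm.mul (hW.pow_const _)) (hW.pow_const _).inv
  have h2 : ∫⁻ t, ‖d t‖ₑ ∂μ =
      ∫⁻ t, ((fun t => ‖d t‖ₑ * W t ^ (1 / 2 : ℝ)) * fun t => (W t ^ (1 / 2 : ℝ))⁻¹) t ∂μ := by
    refine lintegral_congr_ae ?_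
    filter_upwards [hW0, hWt] with t h3 h4
    have h5 : W t ^ (1 / 2 : ℝ) ≠ 0 := by simp [h3, h4]
    have h6 : W t ^ (1 / 2 : ℝ) ≠ ⊤ := by simp [h4]
    rw [Pi.mul_apply, mul_assoc, ENNReal.mul_inv_cancel h5 h6, mul_one]
  have h7 : ∀ a : ℝ≥0∞, (a ^ (1 / 2 : ℝ)) ^ (2 : ℝ) = a := fun a => by
    rw [← ENNReal.rpow_mul]; norm_num
  rw [h2]
  refine h1.trans (le_of_eq ?_)
  congr 2
  · refine lintegral_congr fun t => ?_
    rw [ENNReal.mul_rpow_of_nonneg _ _ (by norm_num), h7]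
    norm_num
  · refine lintegral_congr fun t => ?_
    rw [← ENNReal.inv_rpow, h7]

/-- Primitives are stable under a.e. convergence when the derivatives converge in a weighted `L²`
space whose weight has a locally integrable inverse. -/
lemma isPrimitiveAE_of_tendsto_weighted (hI : IsLineSet I) {hn kn : ℕ → ℝ → ℝ}
    (Hn : ∀ n, IsPrimitiveAE I (hn n) (kn n)) (hk : Measurable k) (hkm : ∀ n, Measurable (kn n))
    (hh : ∀ᵐ t ∂(volume.restrict I), Tendsto (fun n => hn n t) atTop (𝓝 (h t)))
    {W : ℝ → ℝ≥0∞} (hW : Measurable W) (hW0 : ∀ᵐ t ∂(volume.restrict I), W t ≠ 0)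
    (hWt : ∀ᵐ t ∂(volume.restrict I), W t ≠ ⊤)
    (hWi : ∀ a b : ℝ, uIcc a b ⊆ I → ∫⁻ t in uIcc a b, (W t)⁻¹ ≠ ⊤)
    (hkn : Tendsto (fun n => ∫⁻ t in I, ‖kn n t - k t‖ₑ ^ 2 * W t) atTop (𝓝 0)) :
    IsPrimitiveAE I h k := by
  refine isPrimitiveAE_of_tendsto hI Hn hk hh fun a b hab => ?_
  have h1 : Tendsto (fun n => ∫⁻ t in uIcc a b, ‖kn n t - k t‖ₑ ^ 2 * W t) atTop (𝓝 0) :=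
    tendsto_of_tendsto_of_tendsto_of_le_of_le tendsto_const_nhds hkn
      (fun _ => zero_le) fun n => lintegral_mono_set hab
  have h2 : Tendsto (fun n => (∫⁻ t in uIcc a b, ‖kn n t - k t‖ₑ ^ 2 * W t) ^ (1 / 2 : ℝ) *
      (∫⁻ t in uIcc a b, (W t)⁻¹) ^ (1 / 2 : ℝ)) atTop (𝓝 0) := by
    have h3 := ((ENNReal.continuous_rpow_const (y := (1 / 2 : ℝ))).tendsto 0).comp h1
    rw [ENNReal.zero_rpow_of_pos (by norm_num)] at h3
    have := ENNReal.Tendsto.mul_const (b := (∫⁻ t in uIcc a b, (W t)⁻¹) ^ (1 / 2 : ℝ)) h3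
      (Or.inr (by simp [hWi a b hab]))
    simpa [Function.comp_def] using this
  refine tendsto_of_tendsto_of_tendsto_of_le_of_le tendsto_const_nhds h2 (fun _ => zero_le)
    fun n => ?_
  exact lintegral_enorm_le_weighted ((hkm n).sub hk).aemeasurable hW.aemeasurable
    (ae_restrict_of_ae_restrict_of_subset hab hW0) (ae_restrict_of_ae_restrict_of_subset hab hWt)

/-- Integration by parts against a `C¹` function with compact support in `I`. -/
lemma IsPrimitiveAE.integral_mul_eq (hI : IsLineSet I) (H : IsPrimitiveAE I h k) {P : ℝ → ℝ}
    (hP : ContDiff ℝ 1 P) (hPc : HasCompactSupport P) (hPI : tsupport P ⊆ I) :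
    ∫ t in I, P t * k t = -∫ t in I, deriv P t * h t := by
  rcases (tsupport P).eq_empty_or_nonempty with he | hne
  · have : P = 0 := by simpa [tsupport_eq_empty_iff] using he
    subst this
    simp
  obtain ⟨c, hw⟩ := H.exists_isACVersion hI
  set w := fun t => c + ∫ s in (1 : ℝ)..t, k s
  have hK : IsCompact (tsupport P) := hPc
  have hInf : sInf (tsupport P) ∈ I := hPI (hK.sInf_mem hne)
  obtain ⟨ε, hε, hball⟩ := Metric.isOpen_iff.1 hI.isOpen _ hInf
  set a := sInf (tsupport P) - ε / 2
  set b := sSup (tsupport P) + 1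
  have haI : a ∈ I := hball (by rw [Metric.mem_ball, Real.dist_eq, abs_lt]; constructor <;> simp only [a] <;> linarith)
  have hsub : tsupport P ⊆ Ioo a b := fun x hx =>
    ⟨by have := csInf_le hK.bddBelow hx; simp only [a]; linarith,
     by have := le_csSup hK.bddAbove hx; simp only [b]; linarith⟩
  have hab : a < b := by obtain ⟨x, hx⟩ := hne; exact (hsub hx).1.trans (hsub hx).2
  have hbI : b ∈ I := hI.isUpper hab.le haI
  have hs := hI.uIcc_subset haI hbI
  have hIoc : Ioc a b ⊆ I := (uIoc_of_le hab.le ▸ uIoc_subset_uIcc).trans hs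
  have hPa : P a = 0 := image_eq_zero_of_notMem_tsupport fun hx => lt_irrefl _ (hsub hx).1
  have hPb : P b = 0 := image_eq_zero_of_notMem_tsupport fun hx => lt_irrefl _ (hsub hx).2
  have key := AbsolutelyContinuousOnInterval.integral_mul_deriv_eq_deriv_mul
    (hP.contDiffOn.absolutelyContinuousOnInterval (a := a) (b := b)) (hw.1 a b hs)
  rw [hPa, hPb, zero_mul, zero_mul, sub_zero, zero_sub] at key
  have hred : ∀ F : ℝ → ℝ, (∀ t ∉ tsupport P, F t = 0) → ∫ t in I, F t = ∫ t in a..b, F t := by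
    intro F hF
    rw [intervalIntegral.integral_of_le hab.le]
    refine setIntegral_eq_of_subset_of_forall_sdiff_eq_zero hI.measurableSet hIoc fun t ht => hF t fun hx => ?_
    exact ht.2 (Ioo_subset_Ioc_self (hsub hx))
  rw [hred _ fun t ht => by rw [image_eq_zero_of_notMem_tsupport ht, zero_mul],
    hred _ fun t ht => by
      rw [image_eq_zero_of_notMem_tsupport (fun hx => ht (tsupport_deriv_subset hx)), zero_mul]]
  have hae : ∀ {p : ℝ → Prop}, (∀ᵐ t ∂(volume.restrict I), p t) → ∀ᵐ t, t ∈ uIoc a b → p t := by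
    intro p hp
    have := (ae_restrict_iff' hI.measurableSet).1 hp
    filter_upwards [this] with t ht hm
    exact ht (hs (uIoc_subset_uIcc hm))
  calc ∫ t in a..b, P t * k t = ∫ t in a..b, P t * deriv w t := by
        refine intervalIntegral.integral_congr_ae (hae ?_)
        filter_upwards [H.ae_deriv_eq hI hw] with t ht
        rw [ht.deriv]
    _ = -∫ t in a..b, deriv P t * w t := key
    _ = -∫ t in a..b, deriv P t * h t := by
        congr 1
        refine intervalIntegral.integral_congr_ae (hae ?_)
        filter_upwards [hw.2] with t ht
        rw [ht]

end

section

/-! ### Derivatives along almost all vertical lines -/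

/-- For almost every `x ∈ T`, the function `t ↦ u (x, t)` agrees a.e. on `I` with a primitive of
`t ↦ g (x, t)`. -/
def HasLineDeriv (T I : Set ℝ) (u g : ℝ × ℝ → ℝ) : Prop :=
  ∀ᵐ x ∂(volume.restrict T), IsPrimitiveAE I (fun t => u (x, t)) (fun t => g (x, t))

variable {T I : Set ℝ} {u v g g' : ℝ × ℝ → ℝ}

lemma volume_restrict_prod (T I : Set ℝ) :
    (volume : Measure (ℝ × ℝ)).restrict (T ×ˢ I) =
      (volume.restrict T).prod (volume.restrict I) := by
  rw [Measure.prod_restrict, Measure.volume_eq_prod]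

lemma HasLineDeriv.congr (H : HasLineDeriv T I u g) (huv : u =ᵐ[volume.restrict (T ×ˢ I)] v) :
    HasLineDeriv T I v g := by
  rw [volume_restrict_prod] at huv
  filter_upwards [H, Measure.ae_ae_of_ae_prod huv] with x h1 h2
  exact h1.congr h2

lemma HasLineDeriv.add (hI : IsLineSet I) (H : HasLineDeriv T I u g) (H' : HasLineDeriv T I v g') :
    HasLineDeriv T I (fun p => u p + v p) (fun p => g p + g' p) := by
  filter_upwards [H, H'] with x h1 h2 using h1.add hI h2

lemma HasLineDeriv.const_mul (c : ℝ) (H : HasLineDeriv T I u g) :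
    HasLineDeriv T I (fun p => c * u p) (fun p => c * g p) := by
  filter_upwards [H] with x h1 using h1.const_mul c

lemma HasLineDeriv.unitClamp (hI : IsLineSet I) (H : HasLineDeriv T I u g) :
    HasLineDeriv T I (fun p => unitClamp (u p))
      (fun p => (Ioo (0 : ℝ) 1).indicator 1 (u p) * g p) := by
  filter_upwards [H] with x h1 using h1.unitClamp hI

lemma HasLineDeriv.ae_exists_isACVersion (hI : IsLineSet I) (H : HasLineDeriv T I u g) :
    ∀ᵐ x ∂(volume.restrict T), ∃ w, IsACVersion I (fun t => u (x, t)) w := by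
  filter_upwards [H] with x h1
  obtain ⟨c, hc⟩ := h1.exists_isACVersion hI
  exact ⟨_, hc⟩

/-- A measurable function with absolutely continuous versions on almost all vertical lines has a
jointly measurable line derivative. -/
lemma exists_measurable_hasLineDeriv (hI : IsLineSet I) (hu : Measurable u)
    (h : ∀ᵐ x ∂(volume.restrict T), ∃ w, IsACVersion I (fun t => u (x, t)) w) :
    ∃ g, Measurable g ∧ HasLineDeriv T I u g := by
  refine ⟨fun p => limsup (fun n : ℕ => ((n : ℝ) + 1) *
    (u (p.1, p.2 + ((n : ℝ) + 1)⁻¹) - u p)) atTop, ?_, ?_⟩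
  · exact Measurable.limsup fun n => by fun_prop
  · filter_upwards [h] with x ⟨w, hw⟩
    refine (hw.isPrimitiveAE hI).congr_deriv hI ?_
    filter_upwards [hw.ae_tendsto_slope hI] with t ht
    exact ht.limsup_eq.symm

lemma measurable_primitive (hg : Measurable g) :
    Measurable fun p : ℝ × ℝ => ∫ s in (1 : ℝ)..p.2, g (p.1, s) := by
  simp_rw [intervalIntegral]
  refine Measurable.sub ?_ ?_
  · have : (fun p : ℝ × ℝ => ∫ s in Ioc 1 p.2, g (p.1, s)) = fun p : ℝ × ℝ =>
        ∫ s, {q : (ℝ × ℝ) × ℝ | 1 < q.2 ∧ q.2 ≤ q.1.2}.indicator (fun q => g (q.1.1, q.2)) (p, s) := by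
      funext p
      rw [← integral_indicator measurableSet_Ioc]
      rfl
    rw [this]
    refine (StronglyMeasurable.integral_prod_right' (f := {q : (ℝ × ℝ) × ℝ | 1 < q.2 ∧
      q.2 ≤ q.1.2}.indicator (fun q => g (q.1.1, q.2))) (Measurable.stronglyMeasurable ?_)).measurable
    exact Measurable.indicator (by fun_prop) ((measurableSet_lt measurable_const measurable_snd).inter
      (measurableSet_le measurable_snd (by fun_prop)))
  · have : (fun p : ℝ × ℝ => ∫ s in Ioc p.2 1, g (p.1, s)) = fun p : ℝ × ℝ =>
        ∫ s, {q : (ℝ × ℝ) × ℝ | q.1.2 < q.2 ∧ q.2 ≤ 1}.indicator (fun q => g (q.1.1, q.2)) (p, s) := by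
      funext p
      rw [← integral_indicator measurableSet_Ioc]
      rfl
    rw [this]
    refine (StronglyMeasurable.integral_prod_right' (f := {q : (ℝ × ℝ) × ℝ | q.1.2 < q.2 ∧
      q.2 ≤ 1}.indicator (fun q => g (q.1.1, q.2))) (Measurable.stronglyMeasurable ?_)).measurable
    exact Measurable.indicator (by fun_prop) ((measurableSet_lt (by fun_prop) measurable_snd).inter
      (measurableSet_le measurable_snd measurable_const))

/-- For a function continuous on an open set, the derivative at a point of the set can be tested
on rational increments. -/
lemma hasDerivAt_iff_rat {f : ℝ → ℝ} {d t : ℝ} (hI : IsOpen I) (hf : ContinuousOn f I)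
    (ht : t ∈ I) :
    HasDerivAt f d t ↔ ∀ k : ℕ, ∃ l : ℕ, ∀ q : ℚ, |(q : ℝ)| < ((l : ℝ) + 1)⁻¹ →
      |f (t + q) - f t - q * d| ≤ ((k : ℝ) + 1)⁻¹ * |(q : ℝ)| := by
  rw [hasDerivAt_iff_isLittleO_nhds_zero]
  constructor
  · intro H k
    have h1 := H.def (show 0 < ((k : ℝ) + 1)⁻¹ by positivity)
    obtain ⟨ε, hε, hb⟩ := Metric.eventually_nhds_iff.1 h1
    obtain ⟨l, hl⟩ := exists_nat_one_div_lt hε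
    refine ⟨l, fun q hq => ?_⟩
    rw [one_div] at hl
    simpa only [smul_eq_mul, Real.norm_eq_abs] using hb (show dist (q : ℝ) 0 < ε by rw [Real.dist_eq, sub_zero]; exact hq.trans hl)
  · intro H
    rw [Asymptotics.isLittleO_iff]
    intro c hc
    obtain ⟨k, hk⟩ := exists_nat_one_div_lt hc
    obtain ⟨l, hl⟩ := H k
    obtain ⟨ε, hε, hball⟩ := Metric.isOpen_iff.1 hI t ht
    have hδ : 0 < min (((l : ℝ) + 1)⁻¹) ε := lt_min (by positivity) hε
    refine Metric.eventually_nhds_iff.2 ⟨_, hδ, fun y hy => ?_⟩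
    have hcont : ∀ z ∈ Metric.ball (0 : ℝ) (min (((l : ℝ) + 1)⁻¹) ε),
        ContinuousAt (fun z => f (t + z)) z := by
      intro z hz
      have hz' : t + z ∈ I := hball (by
        rw [Metric.mem_ball, Real.dist_eq, add_sub_cancel_left]
        rw [mem_ball_zero_iff, Real.norm_eq_abs] at hz
        exact hz.trans_le (min_le_right _ _))
      exact ContinuousAt.comp (f := fun z => t + z) (hf.continuousAt (hI.mem_nhds hz'))
        (by fun_prop)
    have hcl : y ∈ closure (Metric.ball (0 : ℝ) (min (((l : ℝ) + 1)⁻¹) ε) ∩ range ((↑) : ℚ → ℝ)) := by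
      rw [mem_closure_iff]
      intro o ho hyo
      obtain ⟨z, hz1, hz2⟩ := (Rat.denseRange_cast (𝕜 := ℝ)).inter_open_nonempty _
        (ho.inter Metric.isOpen_ball) ⟨y, hyo, hy⟩
      exact ⟨z, hz1.1, hz1.2, hz2⟩
    have hmain : |f (t + y) - f t - y * d| ≤ ((k : ℝ) + 1)⁻¹ * |y| := by
      refine ContinuousWithinAt.closure_le
        (f := fun z => |f (t + z) - f t - z * d|) (g := fun z => ((k : ℝ) + 1)⁻¹ * |z|) hcl ?_ ?_ ?_
      · have h1 : ContinuousAt (fun z => z * d) y := by fun_prop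
        exact (((hcont y hy).sub continuousAt_const).sub h1).abs.continuousWithinAt
      · exact Continuous.continuousWithinAt (by fun_prop)
      · rintro z ⟨hz, q, rfl⟩
        rw [mem_ball_zero_iff, Real.norm_eq_abs] at hz
        exact hl q (hz.trans_le (min_le_left _ _))
    rw [one_div] at hk
    simp only [smul_eq_mul, Real.norm_eq_abs]
    exact hmain.trans (mul_le_mul_of_nonneg_right hk.le (abs_nonneg _))

lemma ae_prod_of_ae_left {p : ℝ → Prop} (h : ∀ᵐ x ∂(volume.restrict T), p x) :
    ∀ᵐ q ∂(volume.restrict (T ×ˢ I)), p (q : ℝ × ℝ).1 := by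
  rw [volume_restrict_prod]
  exact Measure.quasiMeasurePreserving_fst.ae h

/-- The derivative of the absolutely continuous version agrees a.e. with the line derivative. -/
lemma HasLineDeriv.ae_deriv_acVersion (hT : MeasurableSet T) (hI : IsLineSet I) (hg : Measurable g)
    (H : HasLineDeriv T I u g) :
    ∀ᵐ p ∂(volume.restrict (T ×ˢ I)),
      deriv (acVersion I fun t => u (p.1, t)) p.2 = g p := by
  set F : ℝ × ℝ → ℝ := fun p => ∫ s in (1 : ℝ)..p.2, g (p.1, s) with hF
  have hFm : Measurable F := measurable_primitive hg
  set M : Set (ℝ × ℝ) := {p | ∀ k : ℕ, ∃ l : ℕ, ∀ q : ℚ, |(q : ℝ)| < ((l : ℝ) + 1)⁻¹ →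
      |F (p.1, p.2 + q) - F p - q * g p| ≤ ((k : ℝ) + 1)⁻¹ * |(q : ℝ)|} with hM
  have hMm : MeasurableSet M := by
    simp only [hM, ofPred_forall, ofPred_exists]
    refine MeasurableSet.iInter fun k => MeasurableSet.iUnion fun l => MeasurableSet.iInter fun q =>
      MeasurableSet.iInter fun _ => measurableSet_le (by fun_prop) measurable_const
  have hcont : ∀ x, IsPrimitiveAE I (fun t => u (x, t)) (fun t => g (x, t)) →
      ContinuousOn (fun t => F (x, t)) I := by
    intro x hx
    have := (locallyAC_primitive hI hx.1 0).continuousOn hI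
    simpa [hF] using this
  have hMae : ∀ᵐ p ∂(volume.restrict (T ×ˢ I)), p ∈ M := by
    rw [volume_restrict_prod, Measure.ae_prod_mem_iff_ae_ae_mem hMm]
    filter_upwards [H] with x hx
    filter_upwards [ae_hasDerivAt_primitive hI hx.1, ae_restrict_mem hI.measurableSet] with t h1 h2
    exact (hasDerivAt_iff_rat hI.isOpen (hcont x hx) h2).1 h1
  filter_upwards [hMae, ae_prod_of_ae_left (I := I) H,
    ae_restrict_mem (hT.prod hI.measurableSet)] with p h1 h2 h3
  exact h2.deriv_acVersion hI h3.2 ((hasDerivAt_iff_rat hI.isOpen (hcont p.1 h2) h3.2).2 h1)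

/-- Line derivatives are stable under a.e. convergence when the derivatives converge fast in a
weighted `L²` space whose weight has a locally integrable inverse along the lines. -/
lemma hasLineDeriv_of_tsum (hI : IsLineSet I) {un gn : ℕ → ℝ × ℝ → ℝ}
    (Hn : ∀ n, HasLineDeriv T I (un n) (gn n)) (hg : Measurable g) (hgn : ∀ n, Measurable (gn n))
    (hu : ∀ᵐ p ∂(volume.restrict (T ×ˢ I)), Tendsto (fun n => un n p) atTop (𝓝 (u p)))
    {W : ℝ × ℝ → ℝ≥0∞} (hW : Measurable W)
    (hW0 : ∀ᵐ p ∂(volume.restrict (T ×ˢ I)), W p ≠ 0 ∧ W p ≠ ⊤)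
    (hWi : ∀ᵐ x ∂(volume.restrict T), ∀ a b : ℝ, uIcc a b ⊆ I →
      ∫⁻ t in uIcc a b, (W (x, t))⁻¹ ≠ ⊤)
    (hsum : ∑' n, ∫⁻ p in T ×ˢ I, ‖gn n p - g p‖ₑ ^ 2 * W p ≠ ⊤) :
    HasLineDeriv T I u g := by
  have hm : ∀ n, Measurable fun p => ‖gn n p - g p‖ₑ ^ 2 * W p := fun n =>
    (((hgn n).sub hg).enorm.pow_const 2).mul hW
  have hs : ∀ᵐ x ∂(volume.restrict T),
      ∑' n, ∫⁻ t in I, ‖gn n (x, t) - g (x, t)‖ₑ ^ 2 * W (x, t) < ⊤ := by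
    refine ae_lt_top (Measurable.tsum fun n => (hm n).lintegral_prod_right') ?_
    rw [lintegral_tsum fun n => (hm n).lintegral_prod_right'.aemeasurable]
    convert hsum using 4 with n
    rw [volume_restrict_prod, lintegral_prod _ (hm n).aemeasurable]
  rw [volume_restrict_prod] at hu hW0
  filter_upwards [ae_all_iff.2 Hn, Measure.ae_ae_of_ae_prod hu, Measure.ae_ae_of_ae_prod hW0, hWi, hs]
    with x h1 h2 h3 h4 h5
  exact isPrimitiveAE_of_tendsto_weighted hI h1 (hg.comp measurable_prodMk_left)
    (fun n => (hgn n).comp measurable_prodMk_left) h2 (hW.comp measurable_prodMk_left)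
    (h3.mono fun _ h => h.1) (h3.mono fun _ h => h.2) h4
    (ENNReal.tendsto_atTop_zero_of_tsum_ne_top h5.ne)

/-- Integration by parts in the second variable. -/
lemma HasLineDeriv.setIntegral_mul_eq (hI : IsLineSet I)
    (H : HasLineDeriv T I u g) {P Q : ℝ × ℝ → ℝ}
    (hP : ∀ x ∈ T, ContDiff ℝ 1 fun t => P (x, t)) (hPc : HasCompactSupport P)
    (hPI : tsupport P ⊆ univ ×ˢ I) (hT : MeasurableSet T)
    (hQ : ∀ x ∈ T, ∀ t, deriv (fun t => P (x, t)) t = Q (x, t))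
    (hi : IntegrableOn (fun p => P p * g p) (T ×ˢ I))
    (hi' : IntegrableOn (fun p => Q p * u p) (T ×ˢ I)) :
    ∫ p in T ×ˢ I, P p * g p = -∫ p in T ×ˢ I, Q p * u p := by
  rw [IntegrableOn, volume_restrict_prod] at hi hi'
  rw [volume_restrict_prod, integral_prod _ hi, integral_prod _ hi', ← integral_neg]
  refine integral_congr_ae ?_
  filter_upwards [H, ae_restrict_mem hT] with x hx hxT
  have hsupp : tsupport (fun t => P (x, t)) ⊆ (fun t => (x, t)) ⁻¹' tsupport P :=
    tsupport_comp_subset_preimage P (by fun_prop)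
  rw [hx.integral_mul_eq hI (hP x hxT) ?_ fun t ht => (hPI (hsupp ht)).2]
  · simp_rw [hQ x hxT]
  · refine HasCompactSupport.of_support_subset_isCompact
      (IsCompact.image hPc continuous_snd) fun t ht => ⟨(x, t), hsupp (subset_tsupport _ ht), rfl⟩

end

section

/-! ### The speed measure -/

variable {ρ β : ℝ} {j : ℕ}

lemma halfPlane_eq_prod : halfPlane = univ ×ˢ Ioi (0 : ℝ) := by
  ext p; simp [halfPlane]

lemma isOpen_halfPlane : IsOpen halfPlane := isOpen_lt continuous_const continuous_snd

lemma isOpen_quadrant : IsOpen quadrant :=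
  (isOpen_lt continuous_const continuous_fst).inter (isOpen_lt continuous_const continuous_snd)

lemma quadrant_subset_halfPlane : quadrant ⊆ halfPlane := fun _ hp => hp.2

lemma measurableSet_halfPlane : MeasurableSet halfPlane := isOpen_halfPlane.measurableSet

/-- The density of the speed measure. -/
def speedDensity (ρ β : ℝ) (j : ℕ) (p : ℝ × ℝ) : ℝ :=
  1 / (√(1 - ρ ^ 2) * |p.1| ^ (β * (1 + j)) * p.2 ^ 2)

lemma measurable_speedDensity : Measurable (speedDensity ρ β j) := by
  unfold speedDensity; fun_prop

lemma speedDensity_nonneg (p : ℝ × ℝ) : 0 ≤ speedDensity ρ β j p := by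
  unfold speedDensity; positivity

lemma sqrt_one_sub_sq_pos (hρ : -1 < ρ ∧ ρ < 1) : 0 < √(1 - ρ ^ 2) :=
  Real.sqrt_pos.2 (by nlinarith [hρ.1, hρ.2])

lemma speedDensity_pos (hρ : -1 < ρ ∧ ρ < 1) {p : ℝ × ℝ} (h1 : p.1 ≠ 0) (h2 : p.2 ≠ 0) :
    0 < speedDensity ρ β j p := by
  have := sqrt_one_sub_sq_pos hρ
  have := abs_pos.2 h1
  unfold speedDensity; positivity

lemma speedMeasure_eq : speedMeasure ρ β j = (volume.restrict halfPlane).withDensity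
    fun p => ENNReal.ofReal (speedDensity ρ β j p) := rfl

lemma ae_fst_ne_zero : ∀ᵐ p ∂(volume.restrict halfPlane), (p : ℝ × ℝ).1 ≠ 0 := by
  rw [halfPlane_eq_prod]
  refine ae_prod_of_ae_left (p := fun x => x ≠ 0) ?_
  rw [Measure.restrict_univ]
  simp [ae_iff, measure_singleton]

lemma ae_speedMeasure_iff (hρ : -1 < ρ ∧ ρ < 1) {P : ℝ × ℝ → Prop} :
    (∀ᵐ p ∂(speedMeasure ρ β j), P p) ↔ ∀ᵐ p ∂(volume.restrict halfPlane), P p := by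
  rw [speedMeasure_eq, ae_withDensity_iff measurable_speedDensity.ennreal_ofReal]
  refine ⟨fun h => ?_, fun h => h.mono fun _ hp _ => hp⟩
  filter_upwards [h, ae_fst_ne_zero, ae_restrict_mem measurableSet_halfPlane] with p h1 h2 h3
  exact h1 (ENNReal.ofReal_pos.2 (speedDensity_pos hρ h2 (ne_of_gt h3))).ne'

lemma eventuallyEq_speedMeasure_iff (hρ : -1 < ρ ∧ ρ < 1) {f g : ℝ × ℝ → ℝ} :
    f =ᵐ[speedMeasure ρ β j] g ↔ f =ᵐ[volume.restrict halfPlane] g :=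
  ae_speedMeasure_iff hρ

lemma lintegral_speedMeasure {f : ℝ × ℝ → ℝ≥0∞} (hf : Measurable f) :
    ∫⁻ p, f p ∂(speedMeasure ρ β j)
      = ∫⁻ p in halfPlane, f p * ENNReal.ofReal (speedDensity ρ β j p) := by
  rw [speedMeasure_eq, lintegral_withDensity_eq_lintegral_mul _
    measurable_speedDensity.ennreal_ofReal hf]
  simp only [Pi.mul_apply, mul_comm]

lemma integral_speedMeasure (f : ℝ × ℝ → ℝ) :
    ∫ p, f p ∂(speedMeasure ρ β j) = ∫ p in halfPlane, speedDensity ρ β j p * f p := by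
  rw [speedMeasure_eq, integral_withDensity_eq_integral_toReal_smul
    measurable_speedDensity.ennreal_ofReal (Eventually.of_forall fun _ => ENNReal.ofReal_lt_top)]
  simp only [ENNReal.toReal_ofReal (speedDensity_nonneg _), smul_eq_mul]

lemma integrable_speedMeasure_iff {f : ℝ × ℝ → ℝ} :
    Integrable f (speedMeasure ρ β j) ↔
      IntegrableOn (fun p => speedDensity ρ β j p * f p) halfPlane := by
  rw [speedMeasure_eq, integrable_withDensity_iff_integrable_smul'
    measurable_speedDensity.ennreal_ofReal (Eventually.of_forall fun _ => ENNReal.ofReal_lt_top)]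
  simp only [ENNReal.toReal_ofReal (speedDensity_nonneg _), smul_eq_mul, IntegrableOn]

/-! ### Gradients -/

/-- `g` is a measurable gradient of `u` on the half-plane, formed along almost all lines parallel
to the axes. -/
structure HasGrad (u : ℝ × ℝ → ℝ) (g : ℝ × ℝ → ℝ × ℝ) : Prop where
  measurable : Measurable g
  fst : HasLineDeriv (Ioi 0) univ (fun p => u p.swap) (fun p => (g p.swap).1)
  snd : HasLineDeriv univ (Ioi 0) u (fun p => (g p).2)

variable {u v : ℝ × ℝ → ℝ} {g h : ℝ × ℝ → ℝ × ℝ}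

lemma ae_restrict_prod_swap {T I : Set ℝ} {P : ℝ × ℝ → Prop}
    (hP : ∀ᵐ p ∂(volume.restrict (T ×ˢ I)), P p) :
    ∀ᵐ p ∂(volume.restrict (I ×ˢ T)), P (Prod.swap p) := by
  rw [volume_restrict_prod] at hP ⊢
  exact Measure.measurePreserving_swap.quasiMeasurePreserving.ae hP

lemma HasGrad.congr (H : HasGrad u g) (huv : u =ᵐ[volume.restrict halfPlane] v) :
    HasGrad v g := by
  rw [halfPlane_eq_prod] at huv
  exact ⟨H.measurable, H.fst.congr (ae_restrict_prod_swap huv), H.snd.congr huv⟩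

lemma HasGrad.add (H : HasGrad u g) (H' : HasGrad v h) :
    HasGrad (fun p => u p + v p) (fun p => g p + h p) :=
  ⟨H.measurable.add H'.measurable, H.fst.add isLineSet_univ H'.fst,
    H.snd.add isLineSet_Ioi H'.snd⟩

lemma HasGrad.const_mul (c : ℝ) (H : HasGrad u g) :
    HasGrad (fun p => c * u p) (fun p => c • g p) :=
  ⟨H.measurable.const_smul c, H.fst.const_mul c, H.snd.const_mul c⟩

lemma HasGrad.unitClamp (hu : Measurable u) (H : HasGrad u g) :
    HasGrad (fun p => unitClamp (u p))
      (fun p => (Ioo (0 : ℝ) 1).indicator (1 : ℝ → ℝ) (u p) • g p) := by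
  have hm : Measurable fun p => (Ioo (0 : ℝ) 1).indicator (1 : ℝ → ℝ) (u p) :=
    (measurable_one.indicator measurableSet_Ioo).comp hu
  exact ⟨hm.smul H.measurable, H.fst.unitClamp isLineSet_univ, H.snd.unitClamp isLineSet_Ioi⟩

lemma HasGrad.acGradient_ae (H : HasGrad u g) :
    acGradient u =ᵐ[volume.restrict halfPlane] g := by
  rw [halfPlane_eq_prod]
  have h1 := ae_restrict_prod_swap (H.fst.ae_deriv_acVersion measurableSet_Ioi isLineSet_univ
    (H.measurable.comp measurable_swap).fst)
  have h2 := H.snd.ae_deriv_acVersion MeasurableSet.univ isLineSet_Ioi H.measurable.snd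
  filter_upwards [h1, h2] with p h3 h4
  exact Prod.ext h3 h4

lemma exists_hasGrad (hu : Measurable u)
    (hx : ∀ᵐ y ∂(volume.restrict (Ioi (0 : ℝ))), ∃ w, IsACVersion univ (fun s => u (s, y)) w)
    (hy : ∀ᵐ x ∂(volume : Measure ℝ), ∃ w, IsACVersion (Ioi 0) (fun t => u (x, t)) w) :
    ∃ g, HasGrad u g := by
  obtain ⟨g₁, hm₁, h₁⟩ := exists_measurable_hasLineDeriv (u := fun p => u p.swap)
    isLineSet_univ (hu.comp measurable_swap) hx
  obtain ⟨g₂, hm₂, h₂⟩ := exists_measurable_hasLineDeriv (T := univ) isLineSet_Ioi hu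
    (by rwa [Measure.restrict_univ])
  exact ⟨fun p => (g₁ p.swap, g₂ p), (hm₁.comp measurable_swap).prodMk hm₂, h₁, h₂⟩

/-! ### The energy form in terms of gradients -/

/-- The first coefficient `y|x|^β a₁` of a gradient in the orthonormal frame of the case
`ρ = 0`. -/
def scaledX (β : ℝ) (g : ℝ × ℝ → ℝ × ℝ) (p : ℝ × ℝ) : ℝ := p.2 * |p.1| ^ β * (g p).1

/-- The second frame coefficient `y a₂` of a gradient. -/
def scaledY (g : ℝ × ℝ → ℝ × ℝ) (p : ℝ × ℝ) : ℝ := p.2 * (g p).2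

lemma gammaGrad_eq (p : ℝ × ℝ) : gammaGrad ρ β p (g p) (h p) =
    scaledX β g p * scaledX β h p + ρ * (scaledX β g p * scaledY h p + scaledY g p * scaledX β h p)
      + scaledY g p * scaledY h p := by
  have : |p.1| ^ (2 * β) = |p.1| ^ β * |p.1| ^ β := by
    rw [mul_comm, Real.rpow_mul (abs_nonneg _), Real.rpow_two, sq]
  unfold gammaGrad scaledX scaledY
  rw [this]
  ring

lemma gammaGrad_self_ge (p : ℝ × ℝ) :
    (1 - |ρ|) * (scaledX β g p ^ 2 + scaledY g p ^ 2) ≤ gammaGrad ρ β p (g p) (g p) := by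
  rw [gammaGrad_eq]
  rcases abs_cases ρ with ⟨h, _⟩ | ⟨h, _⟩ <;> rw [h]
  · nlinarith [sq_nonneg (scaledX β g p + scaledY g p)]
  · nlinarith [sq_nonneg (scaledX β g p - scaledY g p)]

lemma gammaGrad_self_le (hρ : -1 < ρ ∧ ρ < 1) (p : ℝ × ℝ) :
    gammaGrad ρ β p (g p) (g p) ≤ 2 * (scaledX β g p ^ 2 + scaledY g p ^ 2) := by
  rw [gammaGrad_eq]
  nlinarith [sq_nonneg (scaledX β g p + scaledY g p), sq_nonneg (scaledX β g p - scaledY g p)]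

lemma gammaGrad_self_nonneg (hρ : -1 < ρ ∧ ρ < 1) (p a : ℝ × ℝ) : 0 ≤ gammaGrad ρ β p a a := by
  refine le_trans ?_ (gammaGrad_self_ge (g := fun _ => a) p)
  have : 0 ≤ 1 - |ρ| := sub_nonneg.2 (abs_le.2 ⟨hρ.1.le, hρ.2.le⟩)
  positivity

/-- The gradient `g` has finite energy. -/
structure FiniteEnergy (ρ β : ℝ) (j : ℕ) (g : ℝ × ℝ → ℝ × ℝ) : Prop where
  memLp_x : MemLp (scaledX β g) 2 (speedMeasure ρ β j)
  memLp_y : MemLp (scaledY g) 2 (speedMeasure ρ β j)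

lemma measurable_scaledX (hg : Measurable g) : Measurable (scaledX β g) := by
  unfold scaledX; fun_prop

lemma measurable_scaledY (hg : Measurable g) : Measurable (scaledY g) := by
  unfold scaledY; fun_prop

lemma FiniteEnergy.add (hg : FiniteEnergy ρ β j g) (hh : FiniteEnergy ρ β j h) :
    FiniteEnergy ρ β j fun p => g p + h p := by
  constructor
  · convert hg.memLp_x.add hh.memLp_x using 1
    funext p; simp [scaledX]; ring
  · convert hg.memLp_y.add hh.memLp_y using 1
    funext p; simp [scaledY]; ring

lemma FiniteEnergy.const_smul (c : ℝ) (hg : FiniteEnergy ρ β j g) :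
    FiniteEnergy ρ β j fun p => c • g p := by
  constructor
  · convert hg.memLp_x.const_mul c using 1
    funext p; simp [scaledX]; ring
  · convert hg.memLp_y.const_mul c using 1
    funext p; simp [scaledY]; ring

lemma FiniteEnergy.integrable_gammaGrad (hg : FiniteEnergy ρ β j g) (hh : FiniteEnergy ρ β j h) :
    Integrable (fun p => gammaGrad ρ β p (g p) (h p)) (speedMeasure ρ β j) := by
  simp_rw [gammaGrad_eq]
  exact ((hg.memLp_x.integrable_mul hh.memLp_x).add
    (((hg.memLp_x.integrable_mul hh.memLp_y).add
      (hg.memLp_y.integrable_mul hh.memLp_x)).const_mul ρ)).add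
    (hg.memLp_y.integrable_mul hh.memLp_y)

lemma finiteEnergy_of_integrable (hρ : -1 < ρ ∧ ρ < 1) (hg : Measurable g)
    (hi : Integrable (fun p => gammaGrad ρ β p (g p) (g p)) (speedMeasure ρ β j)) :
    FiniteEnergy ρ β j g := by
  have hpos : 0 < 1 - |ρ| := sub_pos.2 (abs_lt.2 hρ)
  have hmX := measurable_scaledX (β := β) hg
  have hmY := measurable_scaledY hg
  constructor
  · rw [memLp_two_iff_integrable_sq hmX.aestronglyMeasurable]
    refine (hi.const_mul (1 - |ρ|)⁻¹).mono' (hmX.pow_const 2).aestronglyMeasurable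
      (Eventually.of_forall fun p => ?_)
    rw [Real.norm_eq_abs, abs_of_nonneg (sq_nonneg _), le_inv_mul_iff₀ hpos]
    refine le_trans ?_ (gammaGrad_self_ge p)
    nlinarith [sq_nonneg (scaledY g p), sq_nonneg (scaledX β g p)]
  · rw [memLp_two_iff_integrable_sq hmY.aestronglyMeasurable]
    refine (hi.const_mul (1 - |ρ|)⁻¹).mono' (hmY.pow_const 2).aestronglyMeasurable
      (Eventually.of_forall fun p => ?_)
    rw [Real.norm_eq_abs, abs_of_nonneg (sq_nonneg _), le_inv_mul_iff₀ hpos]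
    refine le_trans ?_ (gammaGrad_self_ge p)
    nlinarith [sq_nonneg (scaledY g p), sq_nonneg (scaledX β g p)]

lemma HasGrad.gammaAC_ae (hρ : -1 < ρ ∧ ρ < 1) (H : HasGrad u g) (H' : HasGrad v h) :
    gammaAC ρ β u v =ᵐ[speedMeasure ρ β j] fun p => gammaGrad ρ β p (g p) (h p) := by
  rw [eventuallyEq_speedMeasure_iff hρ]
  filter_upwards [H.acGradient_ae, H'.acGradient_ae] with p h1 h2
  rw [gammaAC, h1, h2]

lemma mem_energyDomain_iff (hρ : -1 < ρ ∧ ρ < 1) {u : HilbertL2 ρ β j} :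
    u ∈ energyDomain ρ β j ↔ ∃ g, HasGrad u g ∧ FiniteEnergy ρ β j g := by
  constructor
  · rintro ⟨hx, hy, hi⟩
    obtain ⟨g, hg⟩ := exists_hasGrad (Lp.stronglyMeasurable u).measurable hx hy
    exact ⟨g, hg, finiteEnergy_of_integrable hρ hg.measurable (hi.congr (hg.gammaAC_ae hρ hg))⟩
  · rintro ⟨g, hg, hf⟩
    refine ⟨hg.fst.ae_exists_isACVersion isLineSet_univ, ?_,
      (hf.integrable_gammaGrad hf).congr (hg.gammaAC_ae hρ hg).symm⟩
    simpa using hg.snd.ae_exists_isACVersion isLineSet_Ioi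

lemma energy_eq (hρ : -1 < ρ ∧ ρ < 1) {u v : HilbertL2 ρ β j} (hu : HasGrad u g) (hv : HasGrad v h) :
    energy ρ β j u v = (1 / 2) * ∫ p, gammaGrad ρ β p (g p) (h p) ∂(speedMeasure ρ β j) := by
  rw [energy, integral_congr_ae (hu.gammaAC_ae hρ hv)]

end

section

/-! ### Fast subsequences in `L²` -/

lemma tendsto_lintegral_enorm_sub_sq {α : Type*} [MeasurableSpace α] {μ : Measure α}
    {f : ℕ → Lp ℝ 2 μ} {l : Lp ℝ 2 μ} (h : Tendsto f atTop (𝓝 l)) :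
    Tendsto (fun n => ∫⁻ p, ‖f n p - l p‖ₑ ^ 2 ∂μ) atTop (𝓝 0) := by
  rw [Lp.tendsto_Lp_iff_tendsto_eLpNorm'] at h
  have h1 := ((ENNReal.continuous_pow 2).tendsto 0).comp h
  rw [zero_pow two_ne_zero] at h1
  refine h1.congr fun n => ?_
  have := eLpNorm_nnreal_pow_eq_lintegral (μ := μ) (f := ⇑(f n) - ⇑l) (p := 2) two_ne_zero
  simpa using this

lemma exists_subseq_tsum_ne_top {t : ℕ → ℝ≥0∞} (ht : Tendsto t atTop (𝓝 0)) :
    ∃ φ : ℕ → ℕ, ∑' n, t (φ n) ≠ ⊤ := by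
  obtain ⟨φ, -, hφ⟩ := extraction_forall_of_eventually
    (P := fun n k => t k < 2⁻¹ ^ n) fun n =>
      ht.eventually (gt_mem_nhds (ENNReal.pow_pos (by simp) n))
  refine ⟨φ, ne_top_of_le_ne_top ?_ (ENNReal.tsum_le_tsum fun n => (hφ n).le)⟩
  rw [ENNReal.tsum_geometric]
  simp

lemma exists_subseq_tsum_three {α : Type*} [MeasurableSpace α] {μ : Measure α}
    {u x y : ℕ → Lp ℝ 2 μ} {u' x' y' : Lp ℝ 2 μ} (hu : Tendsto u atTop (𝓝 u'))
    (hx : Tendsto x atTop (𝓝 x')) (hy : Tendsto y atTop (𝓝 y')) :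
    ∃ φ : ℕ → ℕ, ∑' n, ∫⁻ p, ‖u (φ n) p - u' p‖ₑ ^ 2 ∂μ ≠ ⊤ ∧
      ∑' n, ∫⁻ p, ‖x (φ n) p - x' p‖ₑ ^ 2 ∂μ ≠ ⊤ ∧
      ∑' n, ∫⁻ p, ‖y (φ n) p - y' p‖ₑ ^ 2 ∂μ ≠ ⊤ := by
  have h := ((tendsto_lintegral_enorm_sub_sq hu).add (tendsto_lintegral_enorm_sub_sq hx)).add
    (tendsto_lintegral_enorm_sub_sq hy)
  simp only [add_zero] at h
  obtain ⟨φ, hφ⟩ := exists_subseq_tsum_ne_top h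
  exact ⟨φ, ne_top_of_le_ne_top hφ (ENNReal.tsum_le_tsum fun n =>
      le_self_add.trans le_self_add), ne_top_of_le_ne_top hφ (ENNReal.tsum_le_tsum fun n =>
      le_add_self.trans le_self_add), ne_top_of_le_ne_top hφ (ENNReal.tsum_le_tsum fun n =>
      le_add_self)⟩

lemma ae_tendsto_of_tsum {α : Type*} [MeasurableSpace α] {μ : Measure α}
    {u : ℕ → α → ℝ} {v : α → ℝ} (hu : ∀ n, Measurable (u n)) (hv : Measurable v)
    (h : ∑' n, ∫⁻ p, ‖u n p - v p‖ₑ ^ 2 ∂μ ≠ ⊤) :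
    ∀ᵐ p ∂μ, Tendsto (fun n => u n p) atTop (𝓝 (v p)) := by
  have hm : ∀ n, Measurable fun p => ‖u n p - v p‖ₑ ^ 2 := fun n =>
    ((hu n).sub hv).enorm.pow_const 2
  rw [← lintegral_tsum fun n => (hm n).aemeasurable] at h
  filter_upwards [ae_lt_top (Measurable.tsum hm) h] with p hp
  have h1 := ENNReal.tendsto_atTop_zero_of_tsum_ne_top hp.ne
  rw [tendsto_iff_edist_tendsto_0]
  have h2 := ((ENNReal.continuous_rpow_const (y := (1 / 2 : ℝ))).tendsto 0).comp h1
  rw [ENNReal.zero_rpow_of_pos (by norm_num)] at h2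
  refine h2.congr fun n => ?_
  rw [Function.comp_apply, edist_eq_enorm_sub, ← ENNReal.rpow_natCast, ← ENNReal.rpow_mul]
  norm_num

/-! ### Completeness of the energy domain -/

variable {ρ β : ℝ} {j : ℕ} {u : ℝ × ℝ → ℝ} {g : ℝ × ℝ → ℝ × ℝ}

lemma enorm_mul_sq_mul_ofReal (c d m : ℝ) :
    ‖c * d‖ₑ ^ 2 * ENNReal.ofReal m = ‖d‖ₑ ^ 2 * ENNReal.ofReal (c ^ 2 * m) := by
  rw [enorm_mul, mul_pow, ENNReal.ofReal_mul (sq_nonneg c), Real.enorm_eq_ofReal_abs c,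
    ← ENNReal.ofReal_pow (abs_nonneg c), sq_abs]
  ring

lemma locallyIntegrable_abs_rpow {s : ℝ} (hs : -1 < s) :
    LocallyIntegrable (fun x : ℝ => |x| ^ s) := by
  refine locallyIntegrable_of_norm_le_rpow (C := 1) (α := -s) (by simp) (by simp; linarith)
    (Eventually.of_forall fun x => ?_)
    (measurable_norm.pow_const s).aestronglyMeasurable
  rw [Real.norm_eq_abs, abs_of_nonneg (by positivity), neg_neg, one_mul, Real.norm_eq_abs]

lemma hasLineDeriv_y_of_tsum (hρ : -1 < ρ ∧ ρ < 1) {un : ℕ → ℝ × ℝ → ℝ}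
    {gn : ℕ → ℝ × ℝ → ℝ × ℝ} (Hn : ∀ n, HasGrad (un n) (gn n)) (hg : Measurable g)
    (hu : ∀ᵐ p ∂(volume.restrict halfPlane), Tendsto (fun n => un n p) atTop (𝓝 (u p)))
    (hsum : ∑' n, ∫⁻ p, ‖scaledY (gn n) p - scaledY g p‖ₑ ^ 2 ∂(speedMeasure ρ β j) ≠ ⊤) :
    HasLineDeriv univ (Ioi 0) u fun p => (g p).2 := by
  refine hasLineDeriv_of_tsum isLineSet_Ioi (fun n => (Hn n).snd) hg.snd
    (fun n => (Hn n).measurable.snd) (by rwa [← halfPlane_eq_prod])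
    (W := fun p => ENNReal.ofReal (p.2 ^ 2 * speedDensity ρ β j p))
    (by have := measurable_speedDensity (ρ := ρ) (β := β) (j := j); fun_prop) ?_ ?_ ?_
  · rw [← halfPlane_eq_prod]
    filter_upwards [ae_fst_ne_zero, ae_restrict_mem measurableSet_halfPlane] with p h1 h2
    refine ⟨(ENNReal.ofReal_pos.2 ?_).ne', ENNReal.ofReal_ne_top⟩
    have h3 : p.2 ≠ 0 := ne_of_gt h2
    have := speedDensity_pos (β := β) (j := j) hρ h1 h3
    positivity
  · rw [Measure.restrict_univ]
    have h0 : ∀ᵐ x : ℝ, x ≠ 0 := by simp [ae_iff, measure_singleton]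
    filter_upwards [h0] with x hx a b hab
    have hr := sqrt_one_sub_sq_pos hρ
    have hx' := abs_pos.2 hx
    have : ∀ t ∈ uIcc a b, (ENNReal.ofReal (t ^ 2 * speedDensity ρ β j (x, t)))⁻¹
        = (ENNReal.ofReal (1 / (√(1 - ρ ^ 2) * |x| ^ (β * (1 + j)))))⁻¹ := by
      intro t ht
      have ht : 0 < t := hab ht
      congr 2
      simp only [speedDensity]
      field_simp
    rw [setLIntegral_congr_fun measurableSet_uIcc this, setLIntegral_const]
    refine ENNReal.mul_ne_top (ENNReal.inv_ne_top.2 (ENNReal.ofReal_pos.2 (by positivity)).ne') ?_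
    exact isCompact_uIcc.measure_lt_top.ne
  · refine ne_of_eq_of_ne (tsum_congr fun n => ?_) hsum
    have hm : Measurable fun p => ‖scaledY (gn n) p - scaledY g p‖ₑ ^ 2 :=
      ((measurable_scaledY (Hn n).measurable).sub (measurable_scaledY hg)).enorm.pow_const 2
    rw [lintegral_speedMeasure hm, ← halfPlane_eq_prod]
    refine lintegral_congr fun p => ?_
    rw [← enorm_mul_sq_mul_ofReal, scaledY, scaledY, mul_sub]

lemma hasLineDeriv_x_of_tsum (hρ : -1 < ρ ∧ ρ < 1) (hβ : -1 < β * (1 + j) - 2 * β)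
    {un : ℕ → ℝ × ℝ → ℝ} {gn : ℕ → ℝ × ℝ → ℝ × ℝ} (Hn : ∀ n, HasGrad (un n) (gn n))
    (hg : Measurable g)
    (hu : ∀ᵐ p ∂(volume.restrict halfPlane), Tendsto (fun n => un n p) atTop (𝓝 (u p)))
    (hsum : ∑' n, ∫⁻ p, ‖scaledX β (gn n) p - scaledX β g p‖ₑ ^ 2 ∂(speedMeasure ρ β j) ≠ ⊤) :
    HasLineDeriv (Ioi 0) univ (fun p => u p.swap) fun p => (g p.swap).1 := by
  have hWeq : ∀ x t : ℝ, x ≠ 0 → 0 < t →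
      (t * |x| ^ β) ^ 2 * speedDensity ρ β j (x, t)
        = (√(1 - ρ ^ 2) * |x| ^ (β * (1 + j) - 2 * β))⁻¹ := by
    intro x t hx ht
    have hr := sqrt_one_sub_sq_pos hρ
    have hx' := abs_pos.2 hx
    have h2 : |x| ^ (2 * β) = (|x| ^ β) ^ 2 := by
      rw [mul_comm, Real.rpow_mul (abs_nonneg _), Real.rpow_two]
    rw [Real.rpow_sub hx', h2]
    simp only [speedDensity]
    field_simp
  have hm0 := measurable_speedDensity (ρ := ρ) (β := β) (j := j)
  refine hasLineDeriv_of_tsum isLineSet_univ (fun n => (Hn n).fst)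
    (hg.comp measurable_swap).fst (fun n => ((Hn n).measurable.comp measurable_swap).fst)
    (ae_restrict_prod_swap (by rwa [← halfPlane_eq_prod]))
    (W := fun p => ENNReal.ofReal ((p.1 * |p.2| ^ β) ^ 2 * speedDensity ρ β j p.swap))
    (by fun_prop) ?_ ?_ ?_
  · refine ae_restrict_prod_swap (P := fun p => ENNReal.ofReal ((p.2 * |p.1| ^ β) ^ 2 *
      speedDensity ρ β j p) ≠ 0 ∧ ENNReal.ofReal ((p.2 * |p.1| ^ β) ^ 2 *
      speedDensity ρ β j p) ≠ ⊤) ?_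
    rw [← halfPlane_eq_prod]
    filter_upwards [ae_fst_ne_zero, ae_restrict_mem measurableSet_halfPlane] with p h1 h2
    refine ⟨(ENNReal.ofReal_pos.2 ?_).ne', ENNReal.ofReal_ne_top⟩
    have h3 : p.2 ≠ 0 := ne_of_gt h2
    have := speedDensity_pos (β := β) (j := j) hρ h1 h3
    have := abs_pos.2 h1
    positivity
  · filter_upwards [ae_restrict_mem measurableSet_Ioi] with t ht a b _
    have hint := ((locallyIntegrable_abs_rpow hβ).integrableOn_isCompact
      (isCompact_uIcc (a := a) (b := b))).const_mul √(1 - ρ ^ 2)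
    refine ne_top_of_le_ne_top hint.2.ne (le_of_eq (lintegral_congr_ae ?_))
    have h0 : ∀ᵐ x ∂(volume.restrict (uIcc a b)), x ≠ 0 :=
      ae_restrict_of_ae (by simp [ae_iff, measure_singleton])
    filter_upwards [h0] with x hx
    have hr := sqrt_one_sub_sq_pos hρ
    have hx' := abs_pos.2 hx
    have hp : 0 < √(1 - ρ ^ 2) * |x| ^ (β * (1 + j) - 2 * β) := by positivity
    rw [Real.enorm_eq_ofReal_abs, abs_of_pos hp]
    simp only [Prod.swap_prod_mk]
    rw [hWeq x t hx ht, ENNReal.ofReal_inv_of_pos hp, inv_inv]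
  · refine ne_of_eq_of_ne (tsum_congr fun n => ?_) hsum
    have hm : Measurable fun p => ‖scaledX β (gn n) p - scaledX β g p‖ₑ ^ 2 :=
      ((measurable_scaledX (Hn n).measurable).sub (measurable_scaledX hg)).enorm.pow_const 2
    rw [lintegral_speedMeasure hm, halfPlane_eq_prod, volume_restrict_prod, volume_restrict_prod,
      ← lintegral_prod_swap]
    refine lintegral_congr fun p => ?_
    rw [← enorm_mul_sq_mul_ofReal, scaledX, scaledX, ← mul_sub]
    rfl

end

section

variable {ρ β : ℝ} {j : ℕ} {g h : ℝ × ℝ → ℝ × ℝ} {u v : HilbertL2 ρ β j}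

lemma HasGrad.congr_coe (hρ : -1 < ρ ∧ ρ < 1) {f f' : ℝ × ℝ → ℝ} (H : HasGrad f g)
    (hf : f' =ᵐ[speedMeasure ρ β j] f) : HasGrad f' g :=
  H.congr ((eventuallyEq_speedMeasure_iff hρ).1 hf.symm)

lemma HasGrad.coe_add (hρ : -1 < ρ ∧ ρ < 1) (hu : HasGrad u g) (hv : HasGrad v h) :
    HasGrad (u + v : HilbertL2 ρ β j) fun p => g p + h p :=
  (hu.add hv).congr_coe hρ (Lp.coeFn_add u v)

lemma HasGrad.coe_smul (hρ : -1 < ρ ∧ ρ < 1) (c : ℝ) (hu : HasGrad u g) :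
    HasGrad (c • u : HilbertL2 ρ β j) fun p => c • g p :=
  (hu.const_mul c).congr_coe hρ (Lp.coeFn_smul c u)

lemma HasGrad.coe_sub (hρ : -1 < ρ ∧ ρ < 1) (hu : HasGrad u g) (hv : HasGrad v h) :
    HasGrad (u - v : HilbertL2 ρ β j) fun p => g p + (-1 : ℝ) • h p := by
  have := hu.coe_add hρ (hv.coe_smul hρ (-1))
  rwa [neg_one_smul, ← sub_eq_add_neg] at this

lemma hasGrad_zero : HasGrad (fun _ => 0) fun _ => 0 := by
  have hz : ∀ I, IsLineSet I → IsPrimitiveAE I (fun _ => 0) fun _ => 0 := fun I hI => by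
    simpa using isPrimitiveAE_of_contDiff hI (contDiff_const (c := (0 : ℝ)))
  exact ⟨measurable_const, Eventually.of_forall fun _ => hz _ isLineSet_univ,
    Eventually.of_forall fun _ => hz _ isLineSet_Ioi⟩

lemma finiteEnergy_zero : FiniteEnergy ρ β j fun _ => 0 := by
  constructor
  · have : scaledX β (fun _ => 0) = fun _ => 0 := by funext p; simp [scaledX]
    rw [this]; exact MemLp.zero'
  · have : scaledY (fun _ => 0) = fun _ => 0 := by funext p; simp [scaledY]
    rw [this]; exact MemLp.zero'

lemma isSymmetricForm_energyDomain (hρ : -1 < ρ ∧ ρ < 1) (hd : Dense (energyDomain ρ β j)) :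
    IsSymmetricForm (energyDomain ρ β j) (energy ρ β j) where
  zero_mem := (mem_energyDomain_iff hρ).2
    ⟨_, hasGrad_zero.congr_coe hρ (Lp.coeFn_zero _ _ _), finiteEnergy_zero⟩
  add_mem u hu v hv := by
    rw [mem_energyDomain_iff hρ] at hu hv ⊢
    obtain ⟨g, hg, fg⟩ := hu
    obtain ⟨h, hh, fh⟩ := hv
    exact ⟨_, hg.coe_add hρ hh, fg.add fh⟩
  smul_mem c u hu := by
    rw [mem_energyDomain_iff hρ] at hu ⊢
    obtain ⟨g, hg, fg⟩ := hu
    exact ⟨_, hg.coe_smul hρ c, fg.const_smul c⟩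
  dense := hd
  add_left u₁ hu₁ u₂ hu₂ v hv := by
    rw [mem_energyDomain_iff hρ] at hu₁ hu₂ hv
    obtain ⟨g₁, hg₁, fg₁⟩ := hu₁
    obtain ⟨g₂, hg₂, fg₂⟩ := hu₂
    obtain ⟨h, hh, fh⟩ := hv
    rw [energy_eq hρ (hg₁.coe_add hρ hg₂) hh, energy_eq hρ hg₁ hh, energy_eq hρ hg₂ hh, ← mul_add,
      ← integral_add (fg₁.integrable_gammaGrad fh) (fg₂.integrable_gammaGrad fh)]
    congr 2
    funext p
    simp only [gammaGrad, Prod.fst_add, Prod.snd_add]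
    ring
  smul_left c u hu v hv := by
    rw [mem_energyDomain_iff hρ] at hu hv
    obtain ⟨g, hg, fg⟩ := hu
    obtain ⟨h, hh, fh⟩ := hv
    rw [energy_eq hρ (hg.coe_smul hρ c) hh, energy_eq hρ hg hh, mul_left_comm,
      ← integral_const_mul c]
    congr 2
    funext p
    simp only [gammaGrad, Prod.smul_fst, Prod.smul_snd, smul_eq_mul]
    ring
  symm u hu v hv := by
    unfold energy
    congr 2
    funext p
    simp only [gammaAC, gammaGrad]
    ring
  nonneg u hu := mul_nonneg (by norm_num)
    (integral_nonneg fun p => gammaGrad_self_nonneg hρ p _)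

lemma norm_toLp_sq {α : Type*} [MeasurableSpace α] {μ : Measure α} {f : α → ℝ} (hf : MemLp f 2 μ) :
    ‖hf.toLp f‖ ^ 2 = ∫ p, f p ^ 2 ∂μ := by
  rw [← real_inner_self_eq_norm_sq, L2.inner_def]
  refine integral_congr_ae ?_
  filter_upwards [hf.coeFn_toLp] with p hp
  rw [hp]
  simp [sq]

/-- The energy norm dominates the `L²` norms of the function and of its scaled gradient. -/
lemma le_normE1Sq (hρ : -1 < ρ ∧ ρ < 1) (hu : HasGrad u g) (hg : FiniteEnergy ρ β j g) :
    (1 - |ρ|) / 2 * (‖hg.memLp_x.toLp _‖ ^ 2 + ‖hg.memLp_y.toLp _‖ ^ 2) + ‖u‖ ^ 2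
      ≤ normE1Sq (energy ρ β j) u := by
  rw [normE1Sq, energy_eq hρ hu hu, norm_toLp_sq, norm_toLp_sq,
    ← integral_add hg.memLp_x.integrable_sq hg.memLp_y.integrable_sq]
  have h1 : (1 - |ρ|) * ∫ p, (scaledX β g p ^ 2 + scaledY g p ^ 2) ∂(speedMeasure ρ β j)
      ≤ ∫ p, gammaGrad ρ β p (g p) (g p) ∂(speedMeasure ρ β j) := by
    rw [← integral_const_mul]
    exact integral_mono ((hg.memLp_x.integrable_sq.add hg.memLp_y.integrable_sq).const_mul _)
      (hg.integrable_gammaGrad hg) fun p => gammaGrad_self_ge p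
  linarith

lemma normE1Sq_le (hρ : -1 < ρ ∧ ρ < 1) (hu : HasGrad u g) (hg : FiniteEnergy ρ β j g) :
    normE1Sq (energy ρ β j) u
      ≤ ‖hg.memLp_x.toLp _‖ ^ 2 + ‖hg.memLp_y.toLp _‖ ^ 2 + ‖u‖ ^ 2 := by
  rw [normE1Sq, energy_eq hρ hu hu, norm_toLp_sq, norm_toLp_sq,
    ← integral_add hg.memLp_x.integrable_sq hg.memLp_y.integrable_sq]
  have h1 : ∫ p, gammaGrad ρ β p (g p) (g p) ∂(speedMeasure ρ β j)
      ≤ 2 * ∫ p, (scaledX β g p ^ 2 + scaledY g p ^ 2) ∂(speedMeasure ρ β j) := by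
    rw [← integral_const_mul]
    exact integral_mono (hg.integrable_gammaGrad hg)
      ((hg.memLp_x.integrable_sq.add hg.memLp_y.integrable_sq).const_mul _)
      fun p => gammaGrad_self_le hρ p
  linarith

lemma FiniteEnergy.sub (hg : FiniteEnergy ρ β j g) (hh : FiniteEnergy ρ β j h) :
    FiniteEnergy ρ β j fun p => g p + (-1 : ℝ) • h p := hg.add (hh.const_smul (-1))

lemma FiniteEnergy.toLp_x_sub (hg : FiniteEnergy ρ β j g) (hh : FiniteEnergy ρ β j h) :
    (hg.sub hh).memLp_x.toLp _ = hg.memLp_x.toLp _ - hh.memLp_x.toLp _ := by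
  rw [← MemLp.toLp_sub]
  congr 1
  funext p
  simp [scaledX]
  ring

lemma FiniteEnergy.toLp_y_sub (hg : FiniteEnergy ρ β j g) (hh : FiniteEnergy ρ β j h) :
    (hg.sub hh).memLp_y.toLp _ = hg.memLp_y.toLp _ - hh.memLp_y.toLp _ := by
  rw [← MemLp.toLp_sub]
  congr 1
  funext p
  simp [scaledY]
  ring

lemma cauchySeq_of_sq {F : Type*} [SeminormedAddCommGroup F] {x : ℕ → F} {e : ℕ → ℕ → ℝ} {c : ℝ}
    (hc : 0 < c) (hx : ∀ m n, c * ‖x m - x n‖ ^ 2 ≤ e m n)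
    (he : ∀ ε > 0, ∃ N, ∀ m ≥ N, ∀ n ≥ N, e m n < ε) : CauchySeq x := by
  rw [Metric.cauchySeq_iff]
  intro ε hε
  obtain ⟨N, hN⟩ := he (c * ε ^ 2) (by positivity)
  refine ⟨N, fun m hm n hn => ?_⟩
  rw [dist_eq_norm]
  have := lt_of_mul_lt_mul_left ((hx m n).trans_lt (hN m hm n hn)) hc.le
  exact lt_of_pow_lt_pow_left₀ 2 hε.le this

lemma isClosedForm_energyDomain (hρ : -1 < ρ ∧ ρ < 1) (hβ : -1 < β * (1 + j) - 2 * β)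
    (hd : Dense (energyDomain ρ β j)) :
    IsClosedForm (energyDomain ρ β j) (energy ρ β j) where
  toIsSymmetricForm := isSymmetricForm_energyDomain hρ hd
  complete := by
    intro u hu hcau
    choose g hg hf using fun n => (mem_energyDomain_iff hρ).1 (hu n)
    have hpos : 0 < (1 - |ρ|) / 2 := by have := abs_lt.2 hρ; linarith
    have hle : ∀ m n, (1 - |ρ|) / 2 * (‖(hf m).memLp_x.toLp _ - (hf n).memLp_x.toLp _‖ ^ 2
        + ‖(hf m).memLp_y.toLp _ - (hf n).memLp_y.toLp _‖ ^ 2) + ‖u m - u n‖ ^ 2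
        ≤ normE1Sq (energy ρ β j) (u m - u n) := by
      intro m n
      have := le_normE1Sq hρ ((hg m).coe_sub hρ (hg n)) ((hf m).sub (hf n))
      rwa [(hf m).toLp_x_sub (hf n), (hf m).toLp_y_sub (hf n)] at this
    have hcu : CauchySeq u := cauchySeq_of_sq one_pos (fun m n => by
      have := hle m n
      have : 0 ≤ (1 - |ρ|) / 2 * (‖(hf m).memLp_x.toLp _ - (hf n).memLp_x.toLp _‖ ^ 2
        + ‖(hf m).memLp_y.toLp _ - (hf n).memLp_y.toLp _‖ ^ 2) := by positivity
      linarith) hcau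
    have hcx : CauchySeq fun n => (hf n).memLp_x.toLp _ := cauchySeq_of_sq hpos (fun m n => by
      have := hle m n
      have : 0 ≤ (1 - |ρ|) / 2 *
        (‖(hf m).memLp_y.toLp _ - (hf n).memLp_y.toLp _‖ ^ 2) := by positivity
      have := sq_nonneg ‖u m - u n‖
      linarith) hcau
    have hcy : CauchySeq fun n => (hf n).memLp_y.toLp _ := cauchySeq_of_sq hpos (fun m n => by
      have := hle m n
      have : 0 ≤ (1 - |ρ|) / 2 *
        (‖(hf m).memLp_x.toLp _ - (hf n).memLp_x.toLp _‖ ^ 2) := by positivity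
      have := sq_nonneg ‖u m - u n‖
      linarith) hcau
    obtain ⟨v, hv⟩ := cauchySeq_tendsto_of_complete hcu
    obtain ⟨A, hA⟩ := cauchySeq_tendsto_of_complete hcx
    obtain ⟨B, hB⟩ := cauchySeq_tendsto_of_complete hcy
    have hAm := (Lp.stronglyMeasurable A).measurable
    have hBm := (Lp.stronglyMeasurable B).measurable
    set G : ℝ × ℝ → ℝ × ℝ := fun p => (A p / (p.2 * |p.1| ^ β), B p / p.2) with hG
    have hGm : Measurable G := by fun_prop
    have hGx : scaledX β G =ᵐ[speedMeasure ρ β j] A := by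
      rw [eventuallyEq_speedMeasure_iff hρ]
      filter_upwards [ae_fst_ne_zero, ae_restrict_mem measurableSet_halfPlane] with p h1 h2
      have h3 : p.2 ≠ 0 := ne_of_gt h2
      have := abs_pos.2 h1
      simp only [scaledX, hG]
      field_simp
    have hGy : scaledY G =ᵐ[speedMeasure ρ β j] B := by
      rw [eventuallyEq_speedMeasure_iff hρ]
      filter_upwards [ae_restrict_mem measurableSet_halfPlane] with p h2
      have h3 : p.2 ≠ 0 := ne_of_gt h2
      simp only [scaledY, hG]
      field_simp
    have hGf : FiniteEnergy ρ β j G :=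
      ⟨(memLp_congr_ae hGx).2 (Lp.memLp A), (memLp_congr_ae hGy).2 (Lp.memLp B)⟩
    have hGA : hGf.memLp_x.toLp _ = A := Lp.ext (hGf.memLp_x.coeFn_toLp.trans hGx)
    have hGB : hGf.memLp_y.toLp _ = B := Lp.ext (hGf.memLp_y.coeFn_toLp.trans hGy)
    obtain ⟨φ, h1, h2, h3⟩ := exists_subseq_tsum_three hv hA hB
    have hptw : ∀ᵐ p ∂(volume.restrict halfPlane),
        Tendsto (fun n => u (φ n) p) atTop (𝓝 (v p)) := by
      rw [← ae_speedMeasure_iff (β := β) (j := j) hρ]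
      exact ae_tendsto_of_tsum (fun n => (Lp.stronglyMeasurable _).measurable)
        (Lp.stronglyMeasurable _).measurable h1
    have hGrad : HasGrad v G := by
      refine ⟨hGm, hasLineDeriv_x_of_tsum hρ hβ (fun n => hg (φ n)) hGm hptw
        (ne_of_eq_of_ne (tsum_congr fun n => lintegral_congr_ae ?_) h2),
        hasLineDeriv_y_of_tsum hρ (fun n => hg (φ n)) hGm hptw
        (ne_of_eq_of_ne (tsum_congr fun n => lintegral_congr_ae ?_) h3)⟩
      · filter_upwards [hGx, (hf (φ n)).memLp_x.coeFn_toLp] with p h4 h5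
        rw [h4, h5]
      · filter_upwards [hGy, (hf (φ n)).memLp_y.coeFn_toLp] with p h4 h5
        rw [h4, h5]
    refine ⟨v, (mem_energyDomain_iff hρ).2 ⟨G, hGrad, hGf⟩, ?_⟩
    have hupper : ∀ n, normE1Sq (energy ρ β j) (u n - v) ≤ ‖(hf n).memLp_x.toLp _ - A‖ ^ 2
        + ‖(hf n).memLp_y.toLp _ - B‖ ^ 2 + ‖u n - v‖ ^ 2 := by
      intro n
      have := normE1Sq_le hρ ((hg n).coe_sub hρ hGrad) ((hf n).sub hGf)
      rwa [(hf n).toLp_x_sub hGf, (hf n).toLp_y_sub hGf, hGA, hGB] at this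
    have hlower : ∀ n, 0 ≤ normE1Sq (energy ρ β j) (u n - v) := by
      intro n
      have := le_normE1Sq hρ ((hg n).coe_sub hρ hGrad) ((hf n).sub hGf)
      exact le_trans (by positivity) this
    have hlim := (((tendsto_iff_norm_sub_tendsto_zero.1 hA).pow 2).add
      ((tendsto_iff_norm_sub_tendsto_zero.1 hB).pow 2)).add
      ((tendsto_iff_norm_sub_tendsto_zero.1 hv).pow 2)
    norm_num at hlim
    exact squeeze_zero hlower hupper hlim

lemma markov_energyDomain (hρ : -1 < ρ ∧ ρ < 1) (hu : u ∈ energyDomain ρ β j) :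
    ∃ w ∈ energyDomain ρ β j, (w =ᵐ[speedMeasure ρ β j] fun p => min (max (u p) 0) 1) ∧
      energy ρ β j w w ≤ energy ρ β j u u := by
  obtain ⟨g, hg, hf⟩ := (mem_energyDomain_iff hρ).1 hu
  have hum := (Lp.stronglyMeasurable u).measurable
  have hmem : MemLp (fun p => unitClamp (u p)) 2 (speedMeasure ρ β j) := by
    refine (Lp.memLp u).mono
      (lipschitzWith_unitClamp.continuous.measurable.comp hum).aestronglyMeasurable
      (Eventually.of_forall fun p => ?_)
    have := lipschitzWith_unitClamp.dist_le_mul (u p) 0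
    simpa [unitClamp] using this
  have hw : (hmem.toLp _ : HilbertL2 ρ β j) =ᵐ[speedMeasure ρ β j] fun p => unitClamp (u p) :=
    hmem.coeFn_toLp
  have hG := (hg.unitClamp hum).congr_coe hρ hw
  have hle : ∀ p, gammaGrad ρ β p ((Ioo (0 : ℝ) 1).indicator (1 : ℝ → ℝ) (u p) • g p)
      ((Ioo (0 : ℝ) 1).indicator (1 : ℝ → ℝ) (u p) • g p) ≤ gammaGrad ρ β p (g p) (g p) := by
    intro p
    by_cases hp : u p ∈ Ioo (0 : ℝ) 1
    · simp [indicator_of_mem hp]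
    · rw [indicator_of_notMem hp, zero_smul]
      refine le_trans (le_of_eq ?_) (gammaGrad_self_nonneg hρ p (g p))
      simp [gammaGrad]
  have hint : Integrable (fun p => gammaGrad ρ β p
      ((Ioo (0 : ℝ) 1).indicator (1 : ℝ → ℝ) (u p) • g p)
      ((Ioo (0 : ℝ) 1).indicator (1 : ℝ → ℝ) (u p) • g p)) (speedMeasure ρ β j) := by
    refine (hf.integrable_gammaGrad hf).mono' ?_ (Eventually.of_forall fun p => ?_)
    · refine Measurable.aestronglyMeasurable ?_
      have := hG.measurable
      have h1 := this.fst
      have h2 := this.snd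
      unfold gammaGrad
      fun_prop
    · rw [Real.norm_eq_abs, abs_of_nonneg (gammaGrad_self_nonneg hρ p _)]
      exact hle p
  refine ⟨hmem.toLp _, (mem_energyDomain_iff hρ).2
    ⟨_, hG, finiteEnergy_of_integrable hρ hG.measurable hint⟩, hw, ?_⟩
  rw [energy_eq hρ hG hG, energy_eq hρ hg hg]
  exact mul_le_mul_of_nonneg_left (integral_mono hint (hf.integrable_gammaGrad hf) hle)
    (by norm_num)

lemma isDirichletForm_energyDomain (hρ : -1 < ρ ∧ ρ < 1) (hβ : -1 < β * (1 + j) - 2 * β)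
    (hd : Dense (energyDomain ρ β j)) :
    IsDirichletForm (energyDomain ρ β j) (energy ρ β j) where
  toIsClosedForm := isClosedForm_energyDomain hρ hβ hd
  markov _ hu := markov_energyDomain hρ hu

end

section

/-! ### Test functions and their partial derivatives -/

variable {ρ β : ℝ} {j : ℕ} {U : Set (ℝ × ℝ)} {f f' : ℝ × ℝ → ℝ}

lemma hasDerivAt_partialX (hf : Differentiable ℝ f) (p : ℝ × ℝ) :
    HasDerivAt (fun s => f (s, p.2)) (fderiv ℝ f p (1, 0)) p.1 :=
  (hf p).hasFDerivAt.comp_hasDerivAt (f := fun s => (s, p.2)) p.1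
    ((hasDerivAt_id p.1).prodMk (hasDerivAt_const p.1 p.2))

lemma hasDerivAt_partialY (hf : Differentiable ℝ f) (p : ℝ × ℝ) :
    HasDerivAt (fun t => f (p.1, t)) (fderiv ℝ f p (0, 1)) p.2 :=
  (hf p).hasFDerivAt.comp_hasDerivAt (f := fun t => (p.1, t)) p.2
    ((hasDerivAt_const p.2 p.1).prodMk (hasDerivAt_id p.2))

lemma partialX_eq_fderiv (hf : Differentiable ℝ f) : partialX f = fun p => fderiv ℝ f p (1, 0) :=
  funext fun p => (hasDerivAt_partialX hf p).deriv

lemma partialY_eq_fderiv (hf : Differentiable ℝ f) : partialY f = fun p => fderiv ℝ f p (0, 1) :=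
  funext fun p => (hasDerivAt_partialY hf p).deriv

lemma IsTest.differentiable (hf : IsTest U f) : Differentiable ℝ f := hf.1.differentiable (by simp)

lemma IsTest.contDiff_fderiv_apply (hf : IsTest U f) (v : ℝ × ℝ) :
    ContDiff ℝ ∞ fun p => fderiv ℝ f p v :=
  (hf.1.fderiv_right (m := ∞) (by simp)).clm_apply contDiff_const

lemma isTest_fderiv_apply (hf : IsTest U f) (v : ℝ × ℝ) : IsTest U fun p => fderiv ℝ f p v := by
  have hs := tsupport_fderiv_apply_subset (f := f) ℝ v
  exact ⟨hf.contDiff_fderiv_apply v, hf.2.1.of_isClosed_subset (isClosed_tsupport _) hs,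
    hs.trans hf.2.2⟩

lemma IsTest.partialX (hf : IsTest U f) : IsTest U (partialX f) := by
  rw [partialX_eq_fderiv hf.differentiable]
  exact isTest_fderiv_apply hf _

lemma IsTest.partialY (hf : IsTest U f) : IsTest U (partialY f) := by
  rw [partialY_eq_fderiv hf.differentiable]
  exact isTest_fderiv_apply hf _

lemma IsTest.partialX_partialY (hf : IsTest U f) :
    SABR.partialX (SABR.partialY f) = SABR.partialY (SABR.partialX f) := by
  rw [partialX_eq_fderiv hf.partialY.differentiable, partialY_eq_fderiv hf.partialX.differentiable,
    partialX_eq_fderiv hf.differentiable, partialY_eq_fderiv hf.differentiable]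
  funext p
  have hd : DifferentiableAt ℝ (fderiv ℝ f) p :=
    (hf.1.fderiv_right (m := ∞) (by simp)).differentiable (by simp) p
  have hsymm : IsSymmSndFDerivAt ℝ f p :=
    hf.1.contDiffAt.isSymmSndFDerivAt (by
      rw [minSmoothness_of_isRCLikeNormedField]
      exact WithTop.coe_le_coe.2 (le_top (a := (2 : ℕ∞))))
  rw [fderiv_clm_apply hd (differentiableAt_const _), fderiv_clm_apply hd (differentiableAt_const _)]
  simpa using hsymm.eq (1, 0) (0, 1)

lemma IsTest.eq_zero (hf : IsTest U f) {p : ℝ × ℝ} (hp : p ∉ U) : f p = 0 :=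
  image_eq_zero_of_notMem_tsupport fun h => hp (hf.2.2 h)

lemma IsTest.add (hf : IsTest U f) (hf' : IsTest U f') : IsTest U fun p => f p + f' p := by
  have hs : tsupport (fun p => f p + f' p) ⊆ tsupport f ∪ tsupport f' := tsupport_add f f'
  exact ⟨hf.1.add hf'.1, hf.2.1.add hf'.2.1, hs.trans (union_subset hf.2.2 hf'.2.2)⟩

lemma IsTest.mul_of_contDiffOn (hf : IsTest U f) (hU : IsOpen U) {c : ℝ × ℝ → ℝ}
    (hc : ContDiffOn ℝ ∞ c U) : IsTest U fun p => c p * f p := by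
  refine ⟨contDiff_iff_contDiffAt.2 fun p => ?_, hf.2.1.mul_left,
    tsupport_mul_subset_right.trans hf.2.2⟩
  by_cases hp : p ∈ tsupport f
  · exact (hc.contDiffAt (hU.mem_nhds (hf.2.2 hp))).mul hf.1.contDiffAt
  · refine (contDiffAt_const (c := (0 : ℝ))).congr_of_eventuallyEq ?_
    filter_upwards [notMem_tsupport_iff_eventuallyEq.1 hp] with q hq
    rw [hq, Pi.zero_apply, mul_zero]

lemma IsTest.const_mul (c : ℝ) (hf : IsTest U f) : IsTest U fun p => c * f p := by
  exact ⟨contDiff_const.mul hf.1, hf.2.1.mul_left,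
    (tsupport_mul_subset_right (f := fun _ => c)).trans hf.2.2⟩

lemma IsTest.rpow_mul (a : ℝ) (hf : IsTest quadrant f) : IsTest quadrant fun p => p.1 ^ a * f p :=
  hf.mul_of_contDiffOn isOpen_quadrant fun _ hp =>
    (contDiffAt_fst.rpow_const_of_ne (ne_of_gt hp.1)).contDiffWithinAt

/-! ### Local finiteness of the speed measure -/

/-- The speed measure is finite on the compact subsets of `U ⊆ S`. -/
def SpeedFiniteOn (ρ β : ℝ) (j : ℕ) (U : Set (ℝ × ℝ)) : Prop :=
  U ⊆ halfPlane ∧ ∀ K, IsCompact K → K ⊆ U → speedMeasure ρ β j K < ⊤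

lemma speedMeasure_lt_top_of_integrableOn {K : Set (ℝ × ℝ)} (hK : IsCompact K)
    (h : IntegrableOn (speedDensity ρ β j) K) : speedMeasure ρ β j K < ⊤ := by
  rw [speedMeasure_eq, withDensity_apply _ hK.measurableSet]
  have h1 := h.2
  refine lt_of_le_of_lt ?_ h1
  rw [Measure.restrict_restrict hK.measurableSet]
  refine (lintegral_mono_set inter_subset_left).trans (lintegral_mono fun p => ?_)
  rw [Real.enorm_eq_ofReal (speedDensity_nonneg p)]

lemma speedFiniteOn_quadrant (hρ : -1 < ρ ∧ ρ < 1) : SpeedFiniteOn ρ β j quadrant := by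
  refine ⟨quadrant_subset_halfPlane, fun K hK hKU => speedMeasure_lt_top_of_integrableOn hK ?_⟩
  refine ContinuousOn.integrableOn_compact hK fun p hp => ContinuousAt.continuousWithinAt ?_
  have h := hKU hp
  have h1 : |p.1| ≠ 0 := abs_ne_zero.2 (ne_of_gt h.1)
  have h2 : p.2 ≠ 0 := ne_of_gt h.2
  have h3 := sqrt_one_sub_sq_pos hρ
  unfold speedDensity
  refine continuousAt_const.div ?_ (by positivity)
  exact (continuousAt_const.mul ((continuousAt_fst.abs).rpow_const (Or.inl h1))).mul
    (continuousAt_snd.pow 2)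

lemma speedFiniteOn_halfPlane (hβ : β * (1 + j) < 1) :
    SpeedFiniteOn ρ β j halfPlane := by
  refine ⟨Subset.rfl, fun K hK hKU => speedMeasure_lt_top_of_integrableOn hK ?_⟩
  rcases K.eq_empty_or_nonempty with rfl | hne
  · simp
  obtain ⟨q, hq, hmin⟩ := hK.exists_isMinOn hne continuous_snd.continuousOn
  have hq0 : 0 < q.2 := hKU hq
  have hbox : IntegrableOn (fun p : ℝ × ℝ => |p.1| ^ (-(β * (1 + j))) * 1)
      ((Prod.fst '' K) ×ˢ (Prod.snd '' K)) := by
    rw [IntegrableOn, volume_restrict_prod]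
    refine Integrable.mul_prod (f := fun x : ℝ => |x| ^ (-(β * (1 + j)))) (g := fun _ => (1 : ℝ)) ?_ ?_
    · exact (locallyIntegrable_abs_rpow (by linarith)).integrableOn_isCompact
        (hK.image continuous_fst)
    · exact integrableOn_const (hK.image continuous_snd).measure_lt_top.ne
  have hsub : K ⊆ (Prod.fst '' K) ×ˢ (Prod.snd '' K) := fun p hp => ⟨⟨p, hp, rfl⟩, ⟨p, hp, rfl⟩⟩
  refine ((hbox.mono_set hsub).const_mul (1 / (√(1 - ρ ^ 2) * q.2 ^ 2))).mono'
    measurable_speedDensity.aestronglyMeasurable ?_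
  filter_upwards [ae_restrict_mem hK.measurableSet] with p hp
  have hqp : q.2 ≤ p.2 := hmin hp
  have hp0 : 0 < p.2 := hq0.trans_le hqp
  rw [Real.norm_eq_abs, abs_of_nonneg (speedDensity_nonneg p), Real.rpow_neg (abs_nonneg _), mul_one,
    speedDensity]
  rcases (Real.sqrt_nonneg (1 - ρ ^ 2)).eq_or_lt with h0 | h0
  · simp [← h0]
  · have hr : (0 : ℝ) ≤ |p.1| ^ (β * (1 + j)) := by positivity
    have h4 : (p.2 ^ 2)⁻¹ ≤ (q.2 ^ 2)⁻¹ := by gcongr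
    calc 1 / (√(1 - ρ ^ 2) * |p.1| ^ (β * (1 + j)) * p.2 ^ 2)
        = (√(1 - ρ ^ 2))⁻¹ * (|p.1| ^ (β * (1 + j)))⁻¹ * (p.2 ^ 2)⁻¹ := by
          rw [one_div, mul_inv, mul_inv]
      _ ≤ (√(1 - ρ ^ 2))⁻¹ * (|p.1| ^ (β * (1 + j)))⁻¹ * (q.2 ^ 2)⁻¹ := by gcongr
      _ = 1 / (√(1 - ρ ^ 2) * q.2 ^ 2) * (|p.1| ^ (β * (1 + j)))⁻¹ := by
          rw [one_div, mul_inv]; ring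

lemma SpeedFiniteOn.memLp (hU : SpeedFiniteOn ρ β j U) (hf : Continuous f)
    (hc : HasCompactSupport f) (hs : tsupport f ⊆ U) : MemLp f 2 (speedMeasure ρ β j) := by
  have hK : MeasurableSet (tsupport f) := (isClosed_tsupport f).measurableSet
  have : (tsupport f).indicator f = f := indicator_eq_self.2 (subset_tsupport f)
  rw [← this, memLp_indicator_iff_restrict hK]
  have : IsFiniteMeasure ((speedMeasure ρ β j).restrict (tsupport f)) :=
    ⟨by rw [Measure.restrict_apply_univ]; exact hU.2 _ hc hs⟩
  obtain ⟨C, hC⟩ := hf.bounded_above_of_compact_support hc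
  exact MemLp.of_bound hf.aestronglyMeasurable C (Eventually.of_forall hC)

lemma IsTest.memLp (hf : IsTest U f) (hU : SpeedFiniteOn ρ β j U) :
    MemLp f 2 (speedMeasure ρ β j) := hU.memLp hf.1.continuous hf.2.1 hf.2.2

lemma SpeedFiniteOn.integrableOn (hU : SpeedFiniteOn ρ β j U) {K : Set (ℝ × ℝ)} (hK : IsCompact K)
    (hKU : K ⊆ U) (hf : MemLp f 2 (speedMeasure ρ β j)) :
    IntegrableOn (fun p => speedDensity ρ β j p * f p) K := by
  have : IsFiniteMeasure ((speedMeasure ρ β j).restrict K) :=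
    ⟨by rw [Measure.restrict_apply_univ]; exact hU.2 _ hK hKU⟩
  have h1 : Integrable (K.indicator f) (speedMeasure ρ β j) :=
    (integrable_indicator_iff hK.measurableSet).2 ((hf.restrict K).integrable one_le_two)
  rw [integrable_speedMeasure_iff] at h1
  refine (h1.mono_set (hKU.trans hU.1)).congr_fun (fun p hp => ?_) hK.measurableSet
  simp only [indicator_of_mem hp]

/-! ### Test functions in the energy domain -/

/-- The classical gradient. -/
def smoothGrad (f : ℝ × ℝ → ℝ) (p : ℝ × ℝ) : ℝ × ℝ := (partialX f p, partialY f p)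

lemma IsTest.hasGrad (hf : IsTest U f) : HasGrad f (smoothGrad f) := by
  refine ⟨hf.partialX.1.continuous.measurable.prodMk hf.partialY.1.continuous.measurable,
    Eventually.of_forall fun y => ?_, Eventually.of_forall fun x => ?_⟩
  · refine isPrimitiveAE_of_contDiff (f := fun s => f (s, y)) isLineSet_univ ?_
    exact (hf.1.comp (contDiff_id.prodMk contDiff_const)).of_le (by simp)
  · refine isPrimitiveAE_of_contDiff (f := fun t => f (x, t)) isLineSet_Ioi ?_
    exact (hf.1.comp (contDiff_const.prodMk contDiff_id)).of_le (by simp)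

lemma IsTest.finiteEnergy (hβ : 0 ≤ β) (hf : IsTest U f) (hU : SpeedFiniteOn ρ β j U) :
    FiniteEnergy ρ β j (smoothGrad f) := by
  have hc : Continuous fun p : ℝ × ℝ => p.2 * |p.1| ^ β :=
    continuous_snd.mul (continuous_fst.abs.rpow_const fun _ => Or.inr hβ)
  exact ⟨hU.memLp (hc.mul hf.partialX.1.continuous) hf.partialX.2.1.mul_left
    (tsupport_mul_subset_right.trans hf.partialX.2.2), hU.memLp (continuous_snd.mul hf.partialY.1.continuous)
    hf.partialY.2.1.mul_left (tsupport_mul_subset_right.trans hf.partialY.2.2)⟩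

lemma testDomain_subset_energyDomain (hρ : -1 < ρ ∧ ρ < 1) (hβ : 0 ≤ β)
    (hU : SpeedFiniteOn ρ β j halfPlane) : testDomain ρ β j ⊆ energyDomain ρ β j := by
  rintro u ⟨f, hf, huf⟩
  exact (mem_energyDomain_iff hρ).2 ⟨_, hf.hasGrad.congr_coe hρ huf, hf.finiteEnergy hβ hU⟩

/-- `C_0^∞(S)` as a submodule of `H_j`. -/
def testSubmodule (ρ β : ℝ) (j : ℕ) : Submodule ℝ (HilbertL2 ρ β j) where
  carrier := testDomain ρ β j
  zero_mem' := ⟨fun _ => 0, ⟨contDiff_const, HasCompactSupport.zero, by simp [tsupport]⟩,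
    Lp.coeFn_zero _ _ _⟩
  add_mem' := by
    rintro u v ⟨f, hf, hu⟩ ⟨f', hf', hv⟩
    exact ⟨_, hf.add hf', (Lp.coeFn_add u v).trans (hu.add hv)⟩
  smul_mem' := by
    rintro c u ⟨f, hf, hu⟩
    exact ⟨_, hf.const_mul c, (Lp.coeFn_smul c u).trans (hu.const_smul c)⟩

lemma inner_eq_integral {u : HilbertL2 ρ β j} (hu : u =ᵐ[speedMeasure ρ β j] f)
    (v : HilbertL2 ρ β j) : inner ℝ u v = ∫ p, f p * v p ∂(speedMeasure ρ β j) := by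
  rw [L2.inner_def]
  refine integral_congr_ae ?_
  filter_upwards [hu] with p hp
  rw [hp]
  simp [mul_comm]

lemma dense_testDomain (hρ : -1 < ρ ∧ ρ < 1) (hU : SpeedFiniteOn ρ β j halfPlane) :
    Dense (testDomain ρ β j) := by
  change Dense (testSubmodule ρ β j : Set (HilbertL2 ρ β j))
  rw [Submodule.dense_iff_topologicalClosure_eq_top, Submodule.topologicalClosure_eq_top_iff,
    Submodule.eq_bot_iff]
  intro h hh
  rw [Submodule.mem_orthogonal] at hh
  have hloc : LocallyIntegrableOn (fun p => speedDensity ρ β j p * h p) halfPlane := by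
    rw [locallyIntegrableOn_iff isOpen_halfPlane.isLocallyClosed]
    exact fun K hKU hK => hU.integrableOn hK hKU (Lp.memLp h)
  have hzero := isOpen_halfPlane.ae_eq_zero_of_integral_contDiff_smul_eq_zero hloc
    fun f h1 h2 h3 => by
      have hf : IsTest halfPlane f := ⟨h1, h2, h3⟩
      have hfm := hf.memLp hU
      have h4 := hh (hfm.toLp f) ⟨f, hf, hfm.coeFn_toLp⟩
      rw [inner_eq_integral hfm.coeFn_toLp, integral_speedMeasure] at h4
      rw [← h4, ← setIntegral_eq_integral_of_forall_compl_eq_zero (s := halfPlane)]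
      · refine integral_congr_ae (Eventually.of_forall fun p => ?_)
        simp only [smul_eq_mul]
        ring
      · intro p hp
        rw [hf.eq_zero hp, zero_smul]
  refine Lp.ext (EventuallyEq.trans ?_ (Lp.coeFn_zero _ _ _).symm)
  rw [eventuallyEq_speedMeasure_iff hρ]
  filter_upwards [ae_fst_ne_zero, ae_restrict_of_ae hzero,
    ae_restrict_mem measurableSet_halfPlane] with p h1 h2 h3
  exact (mul_eq_zero.1 (h2 h3)).resolve_left (speedDensity_pos hρ h1 (ne_of_gt h3)).ne'

lemma dense_energyDomain (hρ : -1 < ρ ∧ ρ < 1) (hβ : 0 ≤ β) (hU : SpeedFiniteOn ρ β j halfPlane) :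
    Dense (energyDomain ρ β j) :=
  (dense_testDomain hρ hU).mono (testDomain_subset_energyDomain hρ hβ hU)

lemma IsSymmetricForm.restrict {H : Type*} [NormedAddCommGroup H] [InnerProductSpace ℝ H]
    {D : Set H} {E : H → H → ℝ} (hE : IsSymmetricForm D E) {V : Submodule ℝ H}
    (hV : (V : Set H) ⊆ D) (hd : Dense (V : Set H)) : IsSymmetricForm (V : Set H) E where
  zero_mem := V.zero_mem
  add_mem _ hu _ hv := V.add_mem hu hv
  smul_mem c _ hu := V.smul_mem c hu
  dense := hd
  add_left u₁ h₁ u₂ h₂ v hv := hE.add_left u₁ (hV h₁) u₂ (hV h₂) v (hV hv)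
  smul_left c u hu v hv := hE.smul_left c u (hV hu) v (hV hv)
  symm u hu v hv := hE.symm u (hV hu) v (hV hv)
  nonneg u hu := hE.nonneg u (hV hu)

lemma isSymmetricForm_testDomain (hρ : -1 < ρ ∧ ρ < 1) (hβ : 0 ≤ β)
    (hU : SpeedFiniteOn ρ β j halfPlane) :
    IsSymmetricForm (testDomain ρ β j) (energy ρ β j) :=
  (isSymmetricForm_energyDomain hρ (dense_energyDomain hρ hβ hU)).restrict
    (V := testSubmodule ρ β j) (testDomain_subset_energyDomain hρ hβ hU) (dense_testDomain hρ hU)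

end

section

variable {ρ β : ℝ} {j : ℕ} {f f' P Q v : ℝ × ℝ → ℝ} {g : ℝ × ℝ → ℝ × ℝ}

/-! ### Integration by parts on the quadrant -/

lemma IsTest.integrable_mul {U : Set (ℝ × ℝ)} (hP : IsTest U P)
    (hv : ∀ K, IsCompact K → K ⊆ U → IntegrableOn v K) : Integrable fun p => P p * v p := by
  have h1 := hv _ hP.2.1 hP.2.2
  have h2 : IntegrableOn (fun p => P p * v p) (tsupport P) :=
    h1.continuousOn_mul hP.1.continuous.continuousOn hP.2.1
  rwa [integrableOn_iff_integrable_of_support_subset] at h2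
  exact fun p hp => subset_tsupport P fun h0 => hp (by simp [h0])

lemma IsTest.integral_mul_partialY (hP : IsTest quadrant P) (hg : HasGrad v g)
    (hv : ∀ K, IsCompact K → K ⊆ quadrant → IntegrableOn v K)
    (hgi : ∀ K, IsCompact K → K ⊆ quadrant → IntegrableOn (fun p => (g p).2) K) :
    ∫ p in halfPlane, P p * (g p).2 = -∫ p in halfPlane, SABR.partialY P p * v p := by
  rw [halfPlane_eq_prod]
  refine hg.snd.setIntegral_mul_eq isLineSet_Ioi
    (fun x _ => (hP.1.comp (contDiff_const.prodMk contDiff_id)).of_le (by simp)) hP.2.1 ?_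
    MeasurableSet.univ (fun x _ t => rfl) (hP.integrable_mul hgi).integrableOn
    (hP.partialY.integrable_mul hv).integrableOn
  rw [← halfPlane_eq_prod]
  exact hP.2.2.trans quadrant_subset_halfPlane

lemma setIntegral_halfPlane_swap (F : ℝ × ℝ → ℝ) :
    ∫ p in halfPlane, F p = ∫ p in Ioi 0 ×ˢ univ, F p.swap := by
  rw [halfPlane_eq_prod, volume_restrict_prod, volume_restrict_prod, ← integral_prod_swap]

lemma IsTest.integral_mul_partialX (hP : IsTest quadrant P) (hg : HasGrad v g)
    (hv : ∀ K, IsCompact K → K ⊆ quadrant → IntegrableOn v K)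
    (hgi : ∀ K, IsCompact K → K ⊆ quadrant → IntegrableOn (fun p => (g p).1) K) :
    ∫ p in halfPlane, P p * (g p).1 = -∫ p in halfPlane, SABR.partialX P p * v p := by
  rw [setIntegral_halfPlane_swap, setIntegral_halfPlane_swap]
  have hsw : ∀ {F : ℝ × ℝ → ℝ}, Integrable F → Integrable fun p : ℝ × ℝ => F p.swap := fun hF => hF.swap
  refine hg.fst.setIntegral_mul_eq (P := fun p => P p.swap) (Q := fun p => SABR.partialX P p.swap)
    isLineSet_univ
    (fun y _ => (hP.1.comp (contDiff_id.prodMk contDiff_const)).of_le (by simp))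
    (hP.2.1.comp_homeomorph (Homeomorph.prodComm ℝ ℝ)) (by simp)
    measurableSet_Ioi (fun x _ t => rfl) (hsw (hP.integrable_mul hgi)).integrableOn
    (hsw (hP.partialX.integrable_mul hv)).integrableOn

/-! ### The divergence form of the operators -/

/-- The `x`-component of the flux of `f`. -/
def fluxX (ρ β : ℝ) (j : ℕ) (f : ℝ × ℝ → ℝ) (p : ℝ × ℝ) : ℝ :=
  p.1 ^ (2 * β - β * (1 + j)) * partialX f p + ρ * (p.1 ^ (β - β * (1 + j)) * partialY f p)

/-- The `y`-component of the flux of `f`. -/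
def fluxY (ρ β : ℝ) (j : ℕ) (f : ℝ × ℝ → ℝ) (p : ℝ × ℝ) : ℝ :=
  ρ * (p.1 ^ (β - β * (1 + j)) * partialX f p) + p.1 ^ (-(β * (1 + j))) * partialY f p

/-- The operator in divergence form that corresponds to the form with index `j`. -/
def divOperator (ρ β : ℝ) (j : ℕ) (f : ℝ × ℝ → ℝ) (p : ℝ × ℝ) : ℝ :=
  1 / 2 * (p.2 ^ 2 * (p.1 ^ (β * (1 + j)) *
    (partialX (fluxX ρ β j f) p + partialY (fluxY ρ β j f) p)))

lemma IsTest.fluxX (hf : IsTest quadrant f) : IsTest quadrant (fluxX ρ β j f) :=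
  (hf.partialX.rpow_mul _).add ((hf.partialY.rpow_mul _).const_mul ρ)

lemma IsTest.fluxY (hf : IsTest quadrant f) : IsTest quadrant (fluxY ρ β j f) :=
  ((hf.partialX.rpow_mul _).const_mul ρ).add (hf.partialY.rpow_mul _)

lemma IsTest.divOperator (hf : IsTest quadrant f) : IsTest quadrant (divOperator ρ β j f) :=
  (((hf.fluxX.partialX.add hf.fluxY.partialY).rpow_mul _).mul_of_contDiffOn isOpen_quadrant
    (contDiff_snd.pow 2).contDiffOn).const_mul _

lemma speedDensity_mul_gammaGrad (hf : IsTest quadrant f) (p : ℝ × ℝ) :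
    speedDensity ρ β j p * gammaGrad ρ β p (smoothGrad f p) (g p) =
      (√(1 - ρ ^ 2))⁻¹ * (fluxX ρ β j f p * (g p).1 + fluxY ρ β j f p * (g p).2) := by
  by_cases hq : p ∈ quadrant
  · have hx : 0 < p.1 := hq.1
    have hy : 0 < p.2 := hq.2
    simp only [speedDensity, gammaGrad, smoothGrad, SABR.fluxX, SABR.fluxY, abs_of_pos hx,
      Real.rpow_sub hx, Real.rpow_neg hx.le]
    field_simp
    ring
  · rw [hf.fluxX.eq_zero hq, hf.fluxY.eq_zero hq, smoothGrad, hf.partialX.eq_zero hq,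
      hf.partialY.eq_zero hq]
    simp [gammaGrad]

lemma speedDensity_mul_divOperator (hf : IsTest quadrant f) (p : ℝ × ℝ) :
    speedDensity ρ β j p * divOperator ρ β j f p = (√(1 - ρ ^ 2))⁻¹ *
      (1 / 2 * (partialX (fluxX ρ β j f) p + partialY (fluxY ρ β j f) p)) := by
  by_cases hq : p ∈ quadrant
  · have hx : 0 < p.1 := hq.1
    have hy : 0 < p.2 := hq.2
    have hr : 0 < p.1 ^ (β * (1 + j)) := by positivity
    simp only [speedDensity, SABR.divOperator, abs_of_pos hx]
    field_simp
  · rw [hf.divOperator.eq_zero hq, hf.fluxX.partialX.eq_zero hq, hf.fluxY.partialY.eq_zero hq]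
    simp

/-- Local integrability on the quadrant of a function in `H_j` and of a gradient of finite energy. -/
lemma integrableOn_of_memLp (hρ : -1 < ρ ∧ ρ < 1) {c : ℝ × ℝ → ℝ}
    (hc : ContinuousOn c quadrant) (hv : MemLp f 2 (speedMeasure ρ β j))
    (hcv : ∀ p ∈ quadrant, c p * f p = v p) {K : Set (ℝ × ℝ)} (hK : IsCompact K)
    (hKU : K ⊆ quadrant) : IntegrableOn v K := by
  have h1 := (speedFiniteOn_quadrant (β := β) (j := j) hρ).integrableOn hK hKU hv
  have hd : ContinuousOn (fun p : ℝ × ℝ => √(1 - ρ ^ 2) * |p.1| ^ (β * (1 + j)) * p.2 ^ 2)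
      quadrant := by
    intro p hp
    have h1 : |p.1| ≠ 0 := abs_ne_zero.2 (ne_of_gt hp.1)
    exact ((continuousAt_const.mul ((continuousAt_fst.abs).rpow_const (Or.inl h1))).mul
      (continuousAt_snd.pow 2)).continuousWithinAt
  refine (h1.continuousOn_mul ((hc.mul hd).mono hKU) hK).congr_fun (fun p hp => ?_)
    hK.measurableSet
  have hx : 0 < p.1 := (hKU hp).1
  have hy : 0 < p.2 := (hKU hp).2
  have hr := sqrt_one_sub_sq_pos hρ
  have hx' : 0 < |p.1| := abs_pos.2 hx.ne'
  rw [← hcv p (hKU hp)]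
  simp only [speedDensity, Pi.mul_apply]
  field_simp

/-- Green's formula for test functions on the quadrant and functions of finite energy. -/
lemma integral_divOperator_mul (hρ : -1 < ρ ∧ ρ < 1) (hf : IsTest quadrant f)
    (hv : MemLp v 2 (speedMeasure ρ β j)) (hg : HasGrad v g) (hgf : FiniteEnergy ρ β j g) :
    ∫ p, divOperator ρ β j f p * v p ∂(speedMeasure ρ β j) =
      -((1 / 2) * ∫ p, gammaGrad ρ β p (smoothGrad f p) (g p) ∂(speedMeasure ρ β j)) := by
  have hvi : ∀ K, IsCompact K → K ⊆ quadrant → IntegrableOn v K := fun K hK hKU =>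
    integrableOn_of_memLp (c := fun _ => 1) hρ continuousOn_const hv (fun p _ => one_mul _) hK hKU
  have hg1 : ∀ K, IsCompact K → K ⊆ quadrant → IntegrableOn (fun p => (g p).1) K :=
    fun K hK hKU => by
      refine integrableOn_of_memLp (c := fun p => (p.2 * |p.1| ^ β)⁻¹) hρ (fun p hp => ?_)
        hgf.memLp_x (fun p hp => ?_) hK hKU
      · have h1 : |p.1| ≠ 0 := abs_ne_zero.2 (ne_of_gt hp.1)
        have h2 : p.2 ≠ 0 := ne_of_gt hp.2
        refine ContinuousAt.continuousWithinAt (ContinuousAt.inv₀ ?_ (by positivity))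
        exact continuousAt_snd.mul ((continuousAt_fst.abs).rpow_const (Or.inl h1))
      · have h1 : 0 < |p.1| := abs_pos.2 (ne_of_gt hp.1)
        have h2 : p.2 ≠ 0 := ne_of_gt hp.2
        simp only [scaledX]
        field_simp
  have hg2 : ∀ K, IsCompact K → K ⊆ quadrant → IntegrableOn (fun p => (g p).2) K :=
    fun K hK hKU => by
      refine integrableOn_of_memLp (c := fun p => p.2⁻¹) hρ (fun p hp => ?_)
        hgf.memLp_y (fun p hp => ?_) hK hKU
      · have h2 : p.2 ≠ 0 := ne_of_gt hp.2
        exact (continuousAt_snd.inv₀ h2).continuousWithinAt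
      · have h2 : p.2 ≠ 0 := ne_of_gt hp.2
        simp only [scaledY]
        field_simp
  have e1 : ∫ p in halfPlane, speedDensity ρ β j p * gammaGrad ρ β p (smoothGrad f p) (g p) =
      (√(1 - ρ ^ 2))⁻¹ * (∫ p in halfPlane, fluxX ρ β j f p * (g p).1) +
      (√(1 - ρ ^ 2))⁻¹ * ∫ p in halfPlane, fluxY ρ β j f p * (g p).2 := by
    rw [← mul_add, ← integral_add (hf.fluxX.integrable_mul hg1).integrableOn
      (hf.fluxY.integrable_mul hg2).integrableOn, ← integral_const_mul]
    exact setIntegral_congr_fun measurableSet_halfPlane fun p _ =>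
      speedDensity_mul_gammaGrad hf p
  have e2 : ∫ p in halfPlane, speedDensity ρ β j p * (divOperator ρ β j f p * v p) =
      (√(1 - ρ ^ 2))⁻¹ * (1 / 2 * ((∫ p in halfPlane, partialX (fluxX ρ β j f) p * v p) +
      ∫ p in halfPlane, partialY (fluxY ρ β j f) p * v p)) := by
    rw [← integral_add (hf.fluxX.partialX.integrable_mul hvi).integrableOn
      (hf.fluxY.partialY.integrable_mul hvi).integrableOn, ← integral_const_mul,
      ← integral_const_mul]
    refine setIntegral_congr_fun measurableSet_halfPlane fun p _ => ?_
    rw [← mul_assoc, speedDensity_mul_divOperator hf p]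
    ring
  rw [integral_speedMeasure, integral_speedMeasure, e1, e2,
    hf.fluxX.integral_mul_partialX hg hvi hg1, hf.fluxY.integral_mul_partialY hg hvi hg2]
  ring

/-- `L` is the operator in divergence form on the test functions of the quadrant. -/
def IsDivOperator (ρ β : ℝ) (j : ℕ) (L : (ℝ × ℝ → ℝ) → ℝ × ℝ → ℝ) : Prop :=
  ∀ f, IsTest quadrant f → L f = divOperator ρ β j f

variable {L : (ℝ × ℝ → ℝ) → ℝ × ℝ → ℝ}

lemma formIdentity_of_isDivOperator (hρ : -1 < ρ ∧ ρ < 1) (hβ : 0 ≤ β)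
    (hL : IsDivOperator ρ β j L) : FormIdentity ρ β j L := by
  intro f₁ f₂ h₁ h₂
  have hU := speedFiniteOn_quadrant (β := β) (j := j) hρ
  rw [hL f₁ h₁]
  exact integral_divOperator_mul hρ h₁ (h₂.memLp hU) h₂.hasGrad (h₂.finiteEnergy hβ hU)

lemma generator_eq {H : Type*} [NormedAddCommGroup H] [InnerProductSpace ℝ H] {D : Set H}
    {E : H → H → ℝ} (hD : Dense D) {u w : H} (hw : ∀ v ∈ D, E u v = -inner ℝ w v) :
    generator D E u = w := by
  have hs : ∀ v ∈ D, E u v = -inner ℝ (generator D E u) v :=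
    Classical.epsilon_spec (p := fun w : H => ∀ v ∈ D, E u v = -inner ℝ w v) ⟨w, hw⟩
  refine hD.eq_of_inner_left (𝕜 := ℝ) fun v hv => ?_
  exact neg_injective ((hs v hv).symm.trans (hw v hv))

lemma generatorAgrees_of_isDivOperator (hρ : -1 < ρ ∧ ρ < 1) (hβ : 0 ≤ β)
    (hd : Dense (energyDomain ρ β j)) (hL : IsDivOperator ρ β j L) :
    GeneratorAgrees ρ β j L := by
  intro f₁ h₁ u₁ hu₁
  have hU := speedFiniteOn_quadrant (β := β) (j := j) hρ
  have hm : MemLp (L f₁) 2 (speedMeasure ρ β j) := by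
    rw [hL f₁ h₁]
    exact h₁.divOperator.memLp hU
  have hg₁ := h₁.hasGrad.congr_coe hρ hu₁
  have key : ∀ v ∈ energyDomain ρ β j, energy ρ β j u₁ v = -inner ℝ (hm.toLp (L f₁)) v := by
    intro v hv
    obtain ⟨g, hg, hgf⟩ := (mem_energyDomain_iff hρ).1 hv
    rw [inner_eq_integral hm.coeFn_toLp, energy_eq hρ hg₁ hg, hL f₁ h₁,
      integral_divOperator_mul hρ h₁ (Lp.memLp v) hg hgf, neg_neg]
  have hgen := generator_eq hd key
  have hdom : u₁ ∈ energyDomain ρ β j :=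
    (mem_energyDomain_iff hρ).2 ⟨_, hg₁, h₁.finiteEnergy hβ hU⟩
  refine ⟨⟨hdom, _, key⟩, by rw [hgen]; exact hm.coeFn_toLp, fun f₂ h₂ u₂ hu₂ => ?_⟩
  have hdom₂ : u₂ ∈ energyDomain ρ β j :=
    (mem_energyDomain_iff hρ).2 ⟨_, h₂.hasGrad.congr_coe hρ hu₂, h₂.finiteEnergy hβ hU⟩
  have hint : inner ℝ (hm.toLp (L f₁)) u₂ = ∫ p, L f₁ p * f₂ p ∂(speedMeasure ρ β j) := by
    rw [inner_eq_integral hm.coeFn_toLp]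
    refine integral_congr_ae ?_
    filter_upwards [hu₂] with p hp
    rw [hp]
  refine ⟨by rw [hgen, hint], ?_⟩
  rw [key u₂ hdom₂, neg_neg, hint]

end

section

variable {ρ β : ℝ} {f : ℝ × ℝ → ℝ} {p : ℝ × ℝ}

/-! ### The differential operators in divergence form -/

lemma IsTest.hasDerivAt_x {U : Set (ℝ × ℝ)} (hf : IsTest U f) (p : ℝ × ℝ) :
    HasDerivAt (fun s => f (s, p.2)) (SABR.partialX f p) p.1 :=
  (hasDerivAt_partialX hf.differentiable p).differentiableAt.hasDerivAt

lemma IsTest.hasDerivAt_y {U : Set (ℝ × ℝ)} (hf : IsTest U f) (p : ℝ × ℝ) :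
    HasDerivAt (fun t => f (p.1, t)) (SABR.partialY f p) p.2 :=
  (hasDerivAt_partialY hf.differentiable p).differentiableAt.hasDerivAt

lemma IsTest.partialX_rpow_mul {U : Set (ℝ × ℝ)} (hf : IsTest U f) (a : ℝ) (hp : 0 < p.1) :
    HasDerivAt (fun s => s ^ a * f (s, p.2))
      (a * p.1 ^ (a - 1) * f p + p.1 ^ a * SABR.partialX f p) p.1 :=
  (Real.hasDerivAt_rpow_const (Or.inl hp.ne')).mul (hf.hasDerivAt_x p)

lemma IsTest.partialX_fluxX (hf : IsTest quadrant f) (j : ℕ) (hp : 0 < p.1) :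
    SABR.partialX (SABR.fluxX ρ β j f) p =
      (2 * β - β * (1 + j)) * p.1 ^ (2 * β - β * (1 + j) - 1) * SABR.partialX f p
      + p.1 ^ (2 * β - β * (1 + j)) * SABR.partialX (SABR.partialX f) p
      + ρ * ((β - β * (1 + j)) * p.1 ^ (β - β * (1 + j) - 1) * SABR.partialY f p
      + p.1 ^ (β - β * (1 + j)) * SABR.partialX (SABR.partialY f) p) :=
  ((hf.partialX.partialX_rpow_mul _ hp).add
    ((hf.partialY.partialX_rpow_mul _ hp).const_mul ρ)).deriv

lemma IsTest.partialY_fluxY (hf : IsTest quadrant f) (j : ℕ) :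
    SABR.partialY (SABR.fluxY ρ β j f) p =
      ρ * (p.1 ^ (β - β * (1 + j)) * SABR.partialX (SABR.partialY f) p)
      + p.1 ^ (-(β * (1 + j))) * SABR.partialY (SABR.partialY f) p := by
  rw [hf.partialX_partialY]
  exact ((((hf.partialX.hasDerivAt_y p).const_mul (p.1 ^ (β - β * (1 + j)))).const_mul ρ).add
    ((hf.partialY.hasDerivAt_y p).const_mul (p.1 ^ (-(β * (1 + j)))))).deriv

lemma IsTest.sabrGenerator_eq_zero (hf : IsTest quadrant f) (hp : p ∉ quadrant) :
    sabrGenerator ρ β f p = 0 := by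
  rw [sabrGenerator, hf.partialX.partialX.eq_zero hp, hf.partialY.partialX.eq_zero hp,
    hf.partialY.partialY.eq_zero hp]
  simp

lemma isDivOperator_sabrLaplace : IsDivOperator ρ β 0 (sabrLaplace ρ β) := by
  intro f hf
  funext p
  by_cases hp : p ∈ quadrant
  · have hx : 0 < p.1 := hp.1
    have h2 : p.1 ^ (2 * β) = p.1 ^ β * p.1 ^ β := by rw [two_mul, Real.rpow_add hx]
    have h3 : p.1 ^ (2 * β - 1) = p.1 ^ β * p.1 ^ (β - 1) := by
      rw [← Real.rpow_add hx]; ring_nf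
    have h4 : p.1 ^ β ≠ 0 := by positivity
    rw [divOperator, hf.partialX_fluxX 0 hx, hf.partialY_fluxY 0, sabrLaplace, sabrGenerator, h2, h3]
    have e1 : 2 * β - β * (1 + ((0 : ℕ) : ℝ)) = β := by push_cast; ring
    have e2 : β - β * (1 + ((0 : ℕ) : ℝ)) = 0 := by push_cast; ring
    have e3 : β * (1 + ((0 : ℕ) : ℝ)) = β := by push_cast; ring
    rw [e1, e2, e3, Real.rpow_zero, Real.rpow_neg hx.le]
    field_simp
    ring
  · rw [hf.divOperator.eq_zero hp, sabrLaplace, hf.sabrGenerator_eq_zero hp, hf.partialX.eq_zero hp]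
    simp

lemma isDivOperator_sabrGenerator_zero : IsDivOperator ρ 0 0 (sabrGenerator ρ 0) := by
  intro f hf
  rw [← isDivOperator_sabrLaplace f hf]
  funext p
  simp [sabrLaplace]

lemma isDivOperator_sabrGenerator_one : IsDivOperator 0 β 1 (sabrGenerator 0 β) := by
  intro f hf
  funext p
  by_cases hp : p ∈ quadrant
  · have hx : 0 < p.1 := hp.1
    have h4 : p.1 ^ (2 * β) ≠ 0 := by positivity
    rw [divOperator, hf.partialX_fluxX 1 hx, hf.partialY_fluxY 1, sabrGenerator]
    have e1 : β * (1 + ((1 : ℕ) : ℝ)) = 2 * β := by push_cast; ring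
    rw [e1, sub_self, Real.rpow_zero, Real.rpow_neg hx.le]
    field_simp
    ring
  · rw [hf.divOperator.eq_zero hp, hf.sabrGenerator_eq_zero hp]

/-! ### The Laplace–Beltrami operator -/

lemma sqrt_det_sabrMetric (hρ : -1 < ρ ∧ ρ < 1) (hp : p ∈ quadrant) :
    √(sabrMetric ρ β p).det = (√(1 - ρ ^ 2) * p.1 ^ β * p.2 ^ 2)⁻¹ := by
  have hx : 0 < p.1 := hp.1
  have hy : 0 < p.2 := hp.2
  have hr : 0 < 1 - ρ ^ 2 := by nlinarith [hρ.1, hρ.2]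
  have h2 : p.1 ^ (2 * β) = p.1 ^ β * p.1 ^ β := by rw [two_mul, Real.rpow_add hx]
  have hX : 0 < p.1 ^ β := by positivity
  have hs := Real.sqrt_pos.2 hr
  rw [Real.sqrt_eq_iff_mul_self_eq_of_pos (by positivity), sabrMetric, Matrix.det_smul,
    Matrix.det_fin_two_of, h2, Fintype.card_fin]
  have e : (√(1 - ρ ^ 2) * p.1 ^ β * p.2 ^ 2)⁻¹ * (√(1 - ρ ^ 2) * p.1 ^ β * p.2 ^ 2)⁻¹
      = ((√(1 - ρ ^ 2) * √(1 - ρ ^ 2)) * (p.1 ^ β * p.2 ^ 2) ^ 2)⁻¹ := by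
    rw [← mul_inv]; ring
  rw [e, Real.mul_self_sqrt hr.le]
  field_simp

lemma inv_sabrMetric (hρ : -1 < ρ ∧ ρ < 1) (hp : p ∈ quadrant) :
    (sabrMetric ρ β p)⁻¹ = !![p.2 ^ 2 * p.1 ^ (2 * β), ρ * p.2 ^ 2 * p.1 ^ β;
      ρ * p.2 ^ 2 * p.1 ^ β, p.2 ^ 2] := by
  have hx : 0 < p.1 := hp.1
  have hy : 0 < p.2 := hp.2
  have hr : 1 - ρ ^ 2 ≠ 0 := by nlinarith [hρ.1, hρ.2]
  have h2 : p.1 ^ (2 * β) = p.1 ^ β * p.1 ^ β := by rw [two_mul, Real.rpow_add hx]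
  have hX : 0 < p.1 ^ β := by positivity
  refine Matrix.inv_eq_right_inv ?_
  rw [sabrMetric, h2, Matrix.smul_mul, Matrix.mul_fin_two]
  ext i k
  fin_cases i <;> fin_cases k <;> simp <;> field_simp <;> ring_nf <;> simp

lemma sabrLaplace_eq_laplaceBeltrami (hρ : -1 < ρ ∧ ρ < 1) (hf : IsTest quadrant f)
    (hp : p ∈ quadrant) :
    sabrLaplace ρ β f p = (1 / 2) * laplaceBeltrami (sabrMetric ρ β) f p := by
  have hX : ∀ q ∈ quadrant, √(sabrMetric ρ β q).det *
      ((sabrMetric ρ β q)⁻¹ 0 0 * partialX f q + (sabrMetric ρ β q)⁻¹ 0 1 * partialY f q)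
      = (√(1 - ρ ^ 2))⁻¹ * fluxX ρ β 0 f q := by
    intro q hq
    have hx : 0 < q.1 := hq.1
    have hy : 0 < q.2 := hq.2
    have hr := sqrt_one_sub_sq_pos hρ
    have h2 : q.1 ^ (2 * β) = q.1 ^ β * q.1 ^ β := by rw [two_mul, Real.rpow_add hx]
    have e1 : 2 * β - β * (1 + ((0 : ℕ) : ℝ)) = β := by push_cast; ring
    have e2 : β - β * (1 + ((0 : ℕ) : ℝ)) = 0 := by push_cast; ring
    rw [sqrt_det_sabrMetric hρ hq, inv_sabrMetric hρ hq, fluxX, e1, e2, Real.rpow_zero, h2]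
    simp
    field_simp
  have hY : ∀ q ∈ quadrant, √(sabrMetric ρ β q).det *
      ((sabrMetric ρ β q)⁻¹ 1 0 * partialX f q + (sabrMetric ρ β q)⁻¹ 1 1 * partialY f q)
      = (√(1 - ρ ^ 2))⁻¹ * fluxY ρ β 0 f q := by
    intro q hq
    have hx : 0 < q.1 := hq.1
    have hy : 0 < q.2 := hq.2
    have hr := sqrt_one_sub_sq_pos hρ
    have e2 : β - β * (1 + ((0 : ℕ) : ℝ)) = 0 := by push_cast; ring
    have e3 : β * (1 + ((0 : ℕ) : ℝ)) = β := by push_cast; ring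
    rw [sqrt_det_sabrMetric hρ hq, inv_sabrMetric hρ hq, fluxY, e2, e3, Real.rpow_zero,
      Real.rpow_neg hx.le]
    simp
    field_simp
  have hdX : partialX (fun q => √(sabrMetric ρ β q).det * ((sabrMetric ρ β q)⁻¹ 0 0 * partialX f q
      + (sabrMetric ρ β q)⁻¹ 0 1 * partialY f q)) p
      = (√(1 - ρ ^ 2))⁻¹ * partialX (fluxX ρ β 0 f) p := by
    refine HasDerivAt.deriv (((hf.fluxX.hasDerivAt_x p).const_mul _).congr_of_eventuallyEq ?_)
    have : ∀ᶠ s in 𝓝 p.1, (s, p.2) ∈ quadrant :=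
      (Continuous.continuousAt (by fun_prop)).preimage_mem_nhds (isOpen_quadrant.mem_nhds hp)
    filter_upwards [this] with s hs using hX _ hs
  have hdY : partialY (fun q => √(sabrMetric ρ β q).det * ((sabrMetric ρ β q)⁻¹ 1 0 * partialX f q
      + (sabrMetric ρ β q)⁻¹ 1 1 * partialY f q)) p
      = (√(1 - ρ ^ 2))⁻¹ * partialY (fluxY ρ β 0 f) p := by
    refine HasDerivAt.deriv (((hf.fluxY.hasDerivAt_y p).const_mul _).congr_of_eventuallyEq ?_)
    have : ∀ᶠ t in 𝓝 p.2, (p.1, t) ∈ quadrant :=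
      (Continuous.continuousAt (by fun_prop)).preimage_mem_nhds (isOpen_quadrant.mem_nhds hp)
    filter_upwards [this] with t ht using hY _ ht
  have hr := sqrt_one_sub_sq_pos hρ
  rw [isDivOperator_sabrLaplace f hf, laplaceBeltrami, hdX, hdY, sqrt_det_sabrMetric hρ hp, inv_inv,
    divOperator]
  push_cast
  rw [add_zero, mul_one]
  field_simp

/-! ### Admissible exponents -/

lemma exponents_of_admissible {j : ℕ} (h : (j = 0 ∧ β < 1) ∨ (j = 1 ∧ β < 1 / 2)) :
    β * (1 + j) < 1 ∧ -1 < β * (1 + j) - 2 * β := by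
  rcases h with ⟨rfl, h⟩ | ⟨rfl, h⟩ <;> push_cast <;> constructor <;> linarith

end

end SABR

end

theorem mainTheorem4 (ρ β : ℝ) (hρ : -1 < ρ ∧ ρ < 1) (hβ : 0 ≤ β ∧ β ≤ 1) :
    -- the weighted spaces are Hilbert spaces
    (CompleteSpace (SABR.HilbertL2 ρ β 0) ∧ CompleteSpace (SABR.HilbertL2 ρ β 1)) ∧
    (∀ j : ℕ, ((j = 0 ∧ β < 1) ∨ (j = 1 ∧ β < 1 / 2)) →
      -- (i) the form on smooth compactly supported functions is symmetric and closable
      ((∀ f, SABR.IsTest SABR.halfPlane f → MemLp f 2 (SABR.speedMeasure ρ β j)) ∧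
        (∀ f₁ f₂, SABR.IsTest SABR.halfPlane f₁ → SABR.IsTest SABR.halfPlane f₂ →
          ∀ u₁ u₂ : SABR.HilbertL2 ρ β j,
            u₁ =ᵐ[SABR.speedMeasure ρ β j] f₁ → u₂ =ᵐ[SABR.speedMeasure ρ β j] f₂ →
            Integrable (SABR.gammaSmooth ρ β f₁ f₂) (SABR.speedMeasure ρ β j) ∧
            SABR.energy ρ β j u₁ u₂
              = (1 / 2) * ∫ p, SABR.gammaSmooth ρ β f₁ f₂ p ∂(SABR.speedMeasure ρ β j)) ∧
        SABR.IsSymmetricForm (SABR.testDomain ρ β j) (SABR.energy ρ β j) ∧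
        SABR.IsClosable (SABR.testDomain ρ β j) (SABR.energy ρ β j)) ∧
      -- (ii) on the explicit domain it is a Dirichlet form extending the form in (i)
      (SABR.testDomain ρ β j ⊆ SABR.energyDomain ρ β j ∧
        SABR.IsDirichletForm (SABR.energyDomain ρ β j) (SABR.energy ρ β j))) ∧
    -- (iii) the generator for `j = 0`
    ((∀ f, SABR.IsTest SABR.quadrant f → ∀ p ∈ SABR.quadrant,
        SABR.sabrLaplace ρ β f p
          = (1 / 2) * SABR.laplaceBeltrami (SABR.sabrMetric ρ β) f p) ∧
      SABR.FormIdentity ρ β 0 (SABR.sabrLaplace ρ β) ∧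
      (β < 1 → SABR.GeneratorAgrees ρ β 0 (SABR.sabrLaplace ρ β)) ∧
      (β = 0 → SABR.FormIdentity ρ β 0 (SABR.sabrGenerator ρ β) ∧
        SABR.GeneratorAgrees ρ β 0 (SABR.sabrGenerator ρ β))) ∧
    -- (iv) the generator for `j = 1` in the uncorrelated case
    (ρ = 0 → SABR.FormIdentity ρ β 1 (SABR.sabrGenerator ρ β) ∧
      (β < 1 / 2 → SABR.GeneratorAgrees ρ β 1 (SABR.sabrGenerator ρ β))) := by
  refine ⟨⟨inferInstance, inferInstance⟩, fun j hj => ?_, ⟨fun f hf p hp =>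
    SABR.sabrLaplace_eq_laplaceBeltrami hρ hf hp, ?_, fun hβ1 => ?_, ?_⟩, ?_⟩
  · obtain ⟨h1, h2⟩ := SABR.exponents_of_admissible hj
    have hU := SABR.speedFiniteOn_halfPlane (ρ := ρ) h1
    have hsub := SABR.testDomain_subset_energyDomain hρ hβ.1 hU
    have hD := SABR.isDirichletForm_energyDomain hρ h2 (SABR.dense_energyDomain hρ hβ.1 hU)
    refine ⟨⟨fun f hf => hf.memLp hU, fun f₁ f₂ hf₁ hf₂ u₁ u₂ hu₁ hu₂ => ⟨?_, ?_⟩,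
      SABR.isSymmetricForm_testDomain hρ hβ.1 hU,
      _, _, hD.toIsClosedForm, hsub, fun _ _ _ _ => rfl⟩, hsub, hD⟩
    · exact (hf₁.finiteEnergy hβ.1 hU).integrable_gammaGrad (hf₂.finiteEnergy hβ.1 hU)
    · exact SABR.energy_eq hρ (hf₁.hasGrad.congr_coe hρ hu₁) (hf₂.hasGrad.congr_coe hρ hu₂)
  · exact SABR.formIdentity_of_isDivOperator hρ hβ.1 SABR.isDivOperator_sabrLaplace
  · have h1 := (SABR.exponents_of_admissible (Or.inl ⟨rfl, hβ1⟩)).1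
    exact SABR.generatorAgrees_of_isDivOperator hρ hβ.1
      (SABR.dense_energyDomain hρ hβ.1 (SABR.speedFiniteOn_halfPlane h1))
      SABR.isDivOperator_sabrLaplace
  · rintro rfl
    have h1 := (SABR.exponents_of_admissible (Or.inl ⟨rfl, zero_lt_one⟩)).1
    exact ⟨SABR.formIdentity_of_isDivOperator hρ hβ.1 SABR.isDivOperator_sabrGenerator_zero,
      SABR.generatorAgrees_of_isDivOperator hρ hβ.1
        (SABR.dense_energyDomain hρ hβ.1 (SABR.speedFiniteOn_halfPlane h1))
        SABR.isDivOperator_sabrGenerator_zero⟩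
  · rintro rfl
    refine ⟨SABR.formIdentity_of_isDivOperator hρ hβ.1 SABR.isDivOperator_sabrGenerator_one,
      fun hβ2 => ?_⟩
    have h1 := (SABR.exponents_of_admissible (Or.inr ⟨rfl, hβ2⟩)).1
    exact SABR.generatorAgrees_of_isDivOperator hρ hβ.1
      (SABR.dense_energyDomain hρ hβ.1 (SABR.speedFiniteOn_halfPlane h1))
      SABR.isDivOperator_sabrGenerator_one
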